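/- Let $n\ge 2$ and let $w:\mathbb R\to\mathbb R$ be an even convex function of class $C^3$. For measurable $E\subset\mathbb R^n$ let $$|E|_w=\int_E e^{w(|x|)}\,dx,\qquad P_w(E)=\sup\Big\{\int_E \operatorname{div}\big(e^{w(|x|)}X(x)\big)\,dx:\ X\in C^1_c(\mathbb R^n;\mathbb R^n),\ \|X\|_{L^\infty}\le 1\Big\}$$ be its weighted volume and weighted perimeter, and let $B_r$ be the open ball of radius $r$ centred at the origin. For $r>0$ and a Lipschitz function $u:\mathbb S^{n-1}\to(-1,1)$, the nearly spherical set with radius $r$ and profile $u$ is $$E=\{\,t\,r\,(1+u(x))\,x:\ x\in\mathbb S^{n-1},\ 0\le t\le 1\,\}.$$ Let $0<r_1<r_2$ be such that $w''(r)>0$ for all $r\in[r_1,r_2]$. Then there exist $\varepsilon,c>0$ (depending only on $n,w,r_1,r_2$) such that for every $r\in[r_1,r_2]$ and every nearly spherical set $E$ with radius $r$ and profile $u$ satisfying $\|u\|_{W^{1,\infty}(\mathbb S^{n-1})}=\|u\|_{L^\infty}+\|\nabla_\tau u\|_{L^\infty}<\varepsilon$ and $|E|_w=|B_r|_w$, the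 perimeters $P_w(E)$ and $P_w(B_r)$ are finite and $$P_w(E)-P_w(B_r)\ \ge\ c\,r^{n-1}e^{w(r)}\,\|\nabla_\tau u\|^2_{L^2(\mathbb S^{n-1})},$$ where $\nabla_\tau u$ is the tangential gradient of $u$ (defined almost everywhere) and $\mathbb S^{n-1}$ carries its surface measure. -/

import Mathlib

open MeasureTheory

noncomputable section

/-- The weighted volume `|E|_w = ∫_E e^{w(|x|)} dx`. -/
def weightedVolume {n : ℕ} (w : ℝ → ℝ) (E : Set (EuclideanSpace ℝ (Fin n))) : ENNReal :=
  ∫⁻ x in E, ENNReal.ofReal (Real.exp (w ‖x‖))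

/-- The divergence of a vector field on `ℝⁿ`. -/
def divergence {n : ℕ} (F : EuclideanSpace ℝ (Fin n) → EuclideanSpace ℝ (Fin n))
    (x : EuclideanSpace ℝ (Fin n)) : ℝ :=
  ∑ i : Fin n, (fderiv ℝ F x (EuclideanSpace.single i 1)) i

/-- The weighted perimeter `P_w(E)` in De Giorgi's sense: the supremum of
`∫_E div (e^{w(|x|)} X(x)) dx` over the vector fields `X ∈ C¹_c(ℝⁿ; ℝⁿ)` with `|X| ≤ 1`.
It is `∞` if `E` does not have finite weighted perimeter. (`X = 0` is admissible, so truncating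
the negative values of the integral does not change the supremum.) -/
def weightedPerimeter {n : ℕ} (w : ℝ → ℝ) (E : Set (EuclideanSpace ℝ (Fin n))) : ENNReal :=
  ⨆ (X : EuclideanSpace ℝ (Fin n) → EuclideanSpace ℝ (Fin n))
    (_ : ContDiff ℝ 1 X ∧ HasCompactSupport X ∧ ∀ x, ‖X x‖ ≤ 1),
    ENNReal.ofReal (∫ x in E, divergence (fun y => Real.exp (w ‖y‖) • X y) x)

/-- The unit sphere `S^{n-1}` of `ℝⁿ`. -/
abbrev UnitSphere (n : ℕ) : Type := Metric.sphere (0 : EuclideanSpace ℝ (Fin n)) 1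

/-- The surface measure `ℋ^{n-1}` on `S^{n-1}`, in the usual normalization (that of
integration in polar coordinates). -/
def surfaceMeasure (n : ℕ) : Measure (UnitSphere n) :=
  (volume : Measure (EuclideanSpace ℝ (Fin n))).toSphere

/-- The extension `y ↦ u (y / |y|)` of a function on the sphere, homogeneous of degree `0`
(with the irrelevant value `0` at the origin). -/
def homogeneousExtension {n : ℕ} (u : UnitSphere n → ℝ) (y : EuclideanSpace ℝ (Fin n)) : ℝ :=
  open Classical in
  if hy : y ≠ 0 then
    u ⟨‖y‖⁻¹ • y, by simp [norm_smul, inv_mul_cancel₀ (norm_ne_zero_iff.mpr hy)]⟩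
  else 0

/-- The tangential gradient `∇_τ u` of a function on the sphere: the gradient at the points of the
sphere of the extension that is constant along rays. For a Lipschitz `u` the extension is
differentiable at almost every point of the sphere; at the other points the value is `0`. -/
def tangentialGradient {n : ℕ} (u : UnitSphere n → ℝ) (x : UnitSphere n) :
    EuclideanSpace ℝ (Fin n) :=
  gradient (homogeneousExtension u) (x : EuclideanSpace ℝ (Fin n))

/-- The norm `‖u‖_{W^{1,∞}(S^{n-1})} = ‖u‖_{L^∞} + ‖∇_τ u‖_{L^∞}` of a Lipschitz function `u`. -/
def w1InftyNorm {n : ℕ} (u : UnitSphere n → ℝ) : ENNReal :=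
  eLpNorm u ⊤ (surfaceMeasure n) + eLpNorm (tangentialGradient u) ⊤ (surfaceMeasure n)

/-- `E` is the nearly spherical set with radius `r > 0` and Lipschitz profile
`u : S^{n-1} → (-1, 1)`: the region `{t r (1 + u(x)) x : x ∈ S^{n-1}, 0 ≤ t ≤ 1}` enclosed by the
surface `{r (1 + u(x)) x : x ∈ S^{n-1}}`. -/
structure IsNearlySpherical {n : ℕ} (E : Set (EuclideanSpace ℝ (Fin n))) (r : ℝ)
    (u : UnitSphere n → ℝ) : Prop where
  radius_pos : 0 < r
  lipschitz : ∃ K, LipschitzWith K u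
  mem_Ioo : ∀ x, u x ∈ Set.Ioo (-1 : ℝ) 1
  eq_region : E = {y | ∃ x : UnitSphere n, ∃ t ∈ Set.Icc (0 : ℝ) 1,
    y = (t * (r * (1 + u x))) • (x : EuclideanSpace ℝ (Fin n))}

end

/-! ### Polar coordinates -/

section Polar

open Set Measure Filter Topology

variable {n : ℕ}

/-! In polar coordinates everything becomes an integral over the sphere. Put φ(t) = t^(n-1) e^(w t),
with primitive Θ. Then the perimeter of E is the integral of φ(r(1+u)) √(1 + |∇u|²/(1+u)²) and its
volume is the integral of Θ(r(1+u)) (`weightedPerimeter_eq`, `norm_weightedNormal_nearlyGauge`,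
`weightedVolume_eq`). With v = Θ(r(1+u)) - Θ(r), the volume constraint says exactly that v has mean
zero.

Regard φ as a function of Θ. Its first derivative is l = φ'/φ = (n-1)/t + w', and its second is l'/φ
with l' = w'' - (n-1)/t². A one-sided Taylor bound (`sub_ge_of_log_deriv`) gives φ(r(1+u)) - φ(r) ≥
l(r) v - C v², and the linear term integrates to zero. To leading order, the square root gains
φ(r)/2 times ∫|∇u|². Since ∇v = r φ ∇u, the sharp Poincaré inequality (n-1) ∫v² ≤ ∫|∇v|² limits the
loss to the same quantity times max(0, n-1-r²w'')/(n-1). For w = 0 gain and loss cancel to this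
order; w'' > 0 makes the difference positive, uniformly in r by compactness
(`exists_uniform_bounds`, `exists_small_constant`).

The Poincaré inequality on the sphere comes from Gaussian space. Chernoff's argument proves it on
the line, Efron–Stein tensorizes it, and `sphere_poincare` applies it to the extension of v that is
homogeneous of degree 1. That degree contains the linear functions, the extremals of the Gaussian
inequality, so no sharpness is lost: the Gaussian inequality reads n ∫v² ≤ ∫(v² + |∇v|²).

The perimeter formula needs the divergence theorem on a star-shaped Lipschitz domain
(`integral_divergence_eq`). It is obtained by integrating by parts against piecewise linear cutoffs
of the gauge and differentiating along rays. Cauchy–Schwarz then bounds the supremum defining the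
perimeter from above, and L¹ approximation of the normal on the boundary by admissible fields bounds
it from below. -/

lemma finrank_pred (n : ℕ) : Module.finrank ℝ (EuclideanSpace ℝ (Fin n)) - 1 = n - 1 := by simp

instance (n : ℕ) : IsFiniteMeasure (surfaceMeasure n) := by
  unfold surfaceMeasure; infer_instance

lemma polar_measurePreserving (n : ℕ) :
    MeasurePreserving (homeomorphUnitSphereProd (EuclideanSpace ℝ (Fin n)))
      ((volume : Measure (EuclideanSpace ℝ (Fin n))).comap (↑))
      ((surfaceMeasure n).prod (volumeIoiPow (n - 1))) := by
  have := (volume : Measure (EuclideanSpace ℝ (Fin n))).measurePreserving_homeomorphUnitSphereProd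
  rwa [finrank_pred] at this

lemma lintegral_volumeIoiPow (m : ℕ) (f : ℝ → ENNReal) (hf : Measurable f) :
    ∫⁻ s, f s ∂(volumeIoiPow m) = ∫⁻ s in Ioi (0 : ℝ), ENNReal.ofReal (s ^ m) * f s := by
  rw [volumeIoiPow, lintegral_withDensity_eq_lintegral_mul]
  · exact lintegral_subtype_comap measurableSet_Ioi (fun s : ℝ => ENNReal.ofReal (s ^ m) * f s)
  · fun_prop
  · exact hf.comp measurable_subtype_coe

lemma integral_volumeIoiPow (m : ℕ) (f : ℝ → ℝ) :
    ∫ s, f s ∂(volumeIoiPow m) = ∫ s in Ioi (0 : ℝ), s ^ m * f s := by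
  simp only [Measure.volumeIoiPow, ENNReal.ofReal]
  rw [integral_withDensity_eq_integral_smul,
    integral_subtype_comap measurableSet_Ioi fun a ↦ Real.toNNReal (a ^ m) • f a,
    setIntegral_congr_fun measurableSet_Ioi fun x hx ↦ ?_]
  · rw [NNReal.smul_def, Real.coe_toNNReal _ (pow_nonneg hx.out.le _), smul_eq_mul]
  · exact (measurable_subtype_coe.pow_const _).real_toNNReal

lemma homeomorphUnitSphereProd_smul (p : ({0}ᶜ : Set (EuclideanSpace ℝ (Fin n)))) :
    ((homeomorphUnitSphereProd _ p).2 : ℝ) • ((homeomorphUnitSphereProd _ p).1 : EuclideanSpace ℝ (Fin n))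
      = p := by
  have hp : (p : EuclideanSpace ℝ (Fin n)) ≠ 0 := p.2
  simp [smul_smul, mul_inv_cancel₀ (norm_ne_zero_iff.mpr hp)]

lemma lintegral_polar [NeZero n] (f : EuclideanSpace ℝ (Fin n) → ENNReal) (hf : Measurable f) :
    ∫⁻ y, f y = ∫⁻ x : UnitSphere n, ∫⁻ s in Ioi (0 : ℝ),
      ENNReal.ofReal (s ^ (n - 1)) * f (s • (x : EuclideanSpace ℝ (Fin n))) ∂(volume) ∂(surfaceMeasure n) := by
  have : Nonempty (Fin n) := ⟨0⟩
  have h1 : ∫⁻ y, f y = ∫⁻ p : ({0}ᶜ : Set (EuclideanSpace ℝ (Fin n))), f (p : EuclideanSpace ℝ (Fin n)) ∂(volume.comap Subtype.val) := by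
    rw [lintegral_subtype_comap (measurableSet_singleton _).compl f, restrict_compl_singleton]
  have h2 := (polar_measurePreserving n).lintegral_comp_emb
    (Homeomorph.measurableEmbedding _)
    (fun q : UnitSphere n × Ioi (0 : ℝ) => f ((q.2 : ℝ) • (q.1 : EuclideanSpace ℝ (Fin n))))
  simp only [homeomorphUnitSphereProd_smul] at h2
  rw [h1, h2, lintegral_prod _ (by
    refine (hf.comp ?_).aemeasurable
    fun_prop)]
  refine lintegral_congr fun x => ?_
  exact lintegral_volumeIoiPow (n - 1) (fun s => f (s • (x : EuclideanSpace ℝ (Fin n))))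
    (hf.comp (by fun_prop))

lemma integral_polar [NeZero n] (f : EuclideanSpace ℝ (Fin n) → ℝ) (hf : Integrable f) :
    ∫ y, f y = ∫ x : UnitSphere n, ∫ s in Ioi (0 : ℝ),
      s ^ (n - 1) * f (s • (x : EuclideanSpace ℝ (Fin n))) ∂(volume) ∂(surfaceMeasure n) := by
  have : Nonempty (Fin n) := ⟨0⟩
  have h1 : ∫ y, f y = ∫ p : ({0}ᶜ : Set (EuclideanSpace ℝ (Fin n))), f (p : EuclideanSpace ℝ (Fin n)) ∂(volume.comap Subtype.val) := by
    rw [integral_subtype_comap (measurableSet_singleton _).compl f, restrict_compl_singleton]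
  have h2 := (polar_measurePreserving n).integral_comp
    (Homeomorph.measurableEmbedding _)
    (fun q : UnitSphere n × Ioi (0 : ℝ) => f ((q.2 : ℝ) • (q.1 : EuclideanSpace ℝ (Fin n))))
  have h3 := (polar_measurePreserving n).integrable_comp_emb
    (Homeomorph.measurableEmbedding _)
    (g := fun q : UnitSphere n × Ioi (0 : ℝ) => f ((q.2 : ℝ) • (q.1 : EuclideanSpace ℝ (Fin n))))
  simp only [Function.comp_def, homeomorphUnitSphereProd_smul] at h2 h3
  rw [h1, h2, integral_prod _ (by
    rw [← h3, ← Function.comp_def f, ← integrableOn_iff_comap_subtypeVal (by measurability)]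
    exact hf.integrableOn)]
  refine integral_congr_ae (Eventually.of_forall fun x => ?_)
  exact integral_volumeIoiPow (n - 1) (fun s => f (s • (x : EuclideanSpace ℝ (Fin n))))

/-- A property that holds a.e. holds along almost every ray. -/
lemma ae_ae_polar [NeZero n] {p : EuclideanSpace ℝ (Fin n) → Prop} (hp : ∀ᵐ y, p y) :
    ∀ᵐ x : UnitSphere n ∂(surfaceMeasure n), ∀ᵐ s ∂(volume.restrict (Ioi (0 : ℝ))),
      p (s • (x : EuclideanSpace ℝ (Fin n))) := by
  -- A measurable null superset has a measurable indicator, so Tonelli in polar coordinates applies;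
  -- the weight s^(n-1) is positive on the ray and drops out.
  obtain ⟨t, hts, ht, h0⟩ := exists_measurable_superset_of_null hp
  have h1 := lintegral_polar (t.indicator 1) (measurable_one.indicator ht)
  rw [lintegral_indicator_one ht, h0] at h1
  have hm : Measurable (fun q : UnitSphere n × ℝ => ENNReal.ofReal (q.2 ^ (n - 1)) *
      t.indicator 1 (q.2 • (q.1 : EuclideanSpace ℝ (Fin n)))) := by
    refine Measurable.mul (by fun_prop) ((measurable_one.indicator ht).comp (by fun_prop))
  rw [eq_comm, lintegral_eq_zero_iff (Measurable.lintegral_prod_right' hm)] at h1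
  filter_upwards [h1] with x hx
  have hx' := (lintegral_eq_zero_iff
    (hm.comp (by fun_prop : Measurable fun s : ℝ => (x, s)))).mp hx
  clear hx
  filter_upwards [hx', ae_restrict_mem measurableSet_Ioi] with s hs hs0
  by_contra hcon
  have hmem : s • (x : EuclideanSpace ℝ (Fin n)) ∈ t := hts hcon
  have hs0' : (0 : ℝ) < s := hs0
  simp only [Function.comp_apply, Pi.zero_apply, mul_eq_zero, ENNReal.ofReal_eq_zero, indicator_of_mem hmem] at hs
  rcases hs with h | h
  · exact absurd (pow_pos hs0' (n - 1)) (not_lt.mpr h)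
  · simp at h

lemma exists_pos_of_ae_Ioi {q : ℝ → Prop} (h : ∀ᵐ s ∂(volume.restrict (Ioi (0 : ℝ))), q s) :
    ∃ s, 0 < s ∧ q s := by
  have : (ae (volume.restrict (Ioi (0 : ℝ)))).NeBot := by
    rw [ae_neBot]; intro h; simpa using congrArg (fun m => m univ) h
  obtain ⟨s, h1, h2⟩ := (h.and (ae_restrict_mem measurableSet_Ioi)).exists
  exact ⟨s, h2, h1⟩

end Polar

/-! ### The Gaussian Poincaré inequality on the line -/

section GaussianLine

open Set Measure Filter Topology ProbabilityTheory

/-- Cauchy–Schwarz for the increment as an integral of f', obtained by expanding ∫(f' - m)² ≥ 0 with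
m the mean slope. Lipschitz functions are absolutely continuous, hence the fundamental theorem of
calculus. -/
lemma LipschitzWith.sub_sq_le_mul_integral_deriv_sq {K : NNReal} {f : ℝ → ℝ} (hf : LipschitzWith K f)
    {y x : ℝ} (hyx : y ≤ x) :
    (f x - f y) ^ 2 ≤ (x - y) * ∫ t in y..x, (deriv f t) ^ 2 := by
  have hFTC : ∫ t in y..x, deriv f t = f x - f y :=
    (hf.lipschitzOnWith.absolutelyContinuousOnInterval).integral_deriv_eq_sub
  have hbd : ∀ t, ‖deriv f t‖ ≤ K := fun t => norm_deriv_le_of_lipschitz hf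
  have hi1 : IntervalIntegrable (deriv f) volume y x := by
    refine (intervalIntegrable_const (c := (K : ℝ))).mono_fun
      (measurable_deriv f).aestronglyMeasurable (Eventually.of_forall fun t => ?_)
    exact (hbd t).trans (le_abs_self _)
  have hi2 : IntervalIntegrable (fun t => (deriv f t) ^ 2) volume y x := by
    refine (intervalIntegrable_const (c := (K : ℝ) ^ 2)).mono_fun
      ((measurable_deriv f).pow_const 2).aestronglyMeasurable (Eventually.of_forall fun t => ?_)
    simp only [norm_pow]
    refine (pow_le_pow_left₀ (norm_nonneg _) (hbd t) 2).trans ?_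
    simp
  rcases hyx.eq_or_lt with rfl | hlt
  · simp
  set m := (f x - f y) / (x - y) with hm
  have hpos : 0 < x - y := sub_pos.mpr hlt
  have hnn : 0 ≤ ∫ t in y..x, (deriv f t - m) ^ 2 :=
    intervalIntegral.integral_nonneg hyx fun t _ => sq_nonneg _
  have hexp : ∫ t in y..x, (deriv f t - m) ^ 2
      = (∫ t in y..x, (deriv f t) ^ 2) - 2 * m * (f x - f y) + m ^ 2 * (x - y) := by
    have : ∀ t, (deriv f t - m) ^ 2 = (deriv f t) ^ 2 - 2 * m * deriv f t + m ^ 2 := fun t => by ring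
    simp_rw [this]
    rw [intervalIntegral.integral_add (hi2.sub (hi1.const_mul _)) intervalIntegrable_const,
      intervalIntegral.integral_sub hi2 (hi1.const_mul _), intervalIntegral.integral_const_mul, hFTC,
      intervalIntegral.integral_const]
    simp only [smul_eq_mul]; ring
  have hmm : m * (x - y) = f x - f y := by rw [hm]; field_simp
  rw [hexp] at hnn
  have := mul_nonneg hpos.le hnn
  nlinarith

/-- An independent copy turns the variance into an integral of squared increments, which derivatives
control. The same identity yields Jensen's inequality for squares. -/
lemma integral_prod_sub_sq {α : Type*} [MeasurableSpace α] {μ : Measure α} [IsProbabilityMeasure μ]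
    {f : α → ℝ} (hf : MemLp f 2 μ) :
    Integrable (fun p : α × α => (f p.1 - f p.2) ^ 2) (μ.prod μ) ∧
    ∫ p, (f p.1 - f p.2) ^ 2 ∂(μ.prod μ) = 2 * (∫ x, f x ^ 2 ∂μ - (∫ x, f x ∂μ) ^ 2) := by
  have h1 : Integrable f μ := hf.integrable one_le_two
  have h2 : Integrable (fun x => f x ^ 2) μ := hf.integrable_sq
  have e : (fun p : α × α => (f p.1 - f p.2) ^ 2)
      = fun p => f p.1 ^ 2 * 1 - 2 * (f p.1 * f p.2) + 1 * f p.2 ^ 2 := by ext p; ring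
  have i1 : Integrable (fun p : α × α => f p.1 ^ 2 * 1) (μ.prod μ) := h2.mul_prod (integrable_const 1)
  have i2 : Integrable (fun p : α × α => 2 * (f p.1 * f p.2)) (μ.prod μ) := (h1.mul_prod h1).const_mul 2
  have i3 : Integrable (fun p : α × α => 1 * f p.2 ^ 2) (μ.prod μ) :=
    (integrable_const (1 : ℝ)).mul_prod h2
  rw [e]
  refine ⟨(i1.sub i2).add i3, ?_⟩
  have i12 : Integrable (fun p : α × α => f p.1 ^ 2 * 1 - 2 * (f p.1 * f p.2)) (μ.prod μ) := i1.sub i2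
  rw [integral_add i12 i3, integral_sub i1 i2, integral_const_mul,
    integral_prod_mul (fun x => f x ^ 2) (fun _ => (1 : ℝ)), integral_prod_mul f f,
    integral_prod_mul (fun _ => (1 : ℝ)) (fun x => f x ^ 2)]
  simp; ring

lemma hasDerivAt_gaussianPDFReal (t : ℝ) :
    HasDerivAt (fun t => -gaussianPDFReal 0 1 t) (gaussianPDFReal 0 1 t * t) t := by
  simp only [gaussianPDFReal]
  have h : HasDerivAt (fun t : ℝ => -(t - 0) ^ 2 / (2 * ((1 : NNReal) : ℝ))) (-t) t := by
    have := (((hasDerivAt_id t).sub_const 0).pow 2).neg.div_const (2 * ((1 : NNReal) : ℝ))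
    convert! this using 1
    simp; ring
  have := (h.exp.const_mul (√(2 * Real.pi * ((1 : NNReal) : ℝ)))⁻¹).neg
  convert! this using 1
  ring

lemma integrable_gaussianPDFReal_mul_id :
    Integrable (fun t => gaussianPDFReal 0 1 t * t) := by
  have h : Integrable (fun t : ℝ => t) (gaussianReal 0 1) := IsGaussian.integrable_id
  rw [gaussianReal_of_var_ne_zero _ one_ne_zero, integrable_withDensity_iff_integrable_smul'
    (measurable_gaussianPDF _ _) (by simp [gaussianPDF])] at h
  simpa [gaussianPDF, ENNReal.toReal_ofReal (gaussianPDFReal_nonneg 0 1 _)] using h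

/-- The Gaussian density satisfies φ'(x) = -x φ(x), so the integrand is an exact derivative. -/
lemma setIntegral_Ioi_id_gaussianReal (t : ℝ) :
    ∫ x in Ioi t, x ∂(gaussianReal 0 1) = gaussianPDFReal 0 1 t := by
  have htend : Tendsto (fun t => -gaussianPDFReal 0 1 t) atTop (𝓝 (-0)) := by
    refine Tendsto.neg ?_
    rw [gaussianPDFReal_def]
    have e : (fun x : ℝ => -(x - 0) ^ 2 / (2 * ((1 : NNReal) : ℝ))) = fun x => -(x ^ 2 / 2) := by
      ext x; simp; ring
    have h := (Real.tendsto_exp_atBot.comp (tendsto_neg_atTop_atBot.comp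
      ((tendsto_pow_atTop (α := ℝ) two_ne_zero).atTop_div_const two_pos))).const_mul
      (√(2 * Real.pi * ((1 : NNReal) : ℝ)))⁻¹
    rw [mul_zero] at h
    refine h.congr fun x => ?_
    simp only [Function.comp_apply, ← congrFun e x]
  have h := integral_Ioi_of_hasDerivAt_of_tendsto (a := t)
    (hasDerivAt_gaussianPDFReal t).continuousAt.continuousWithinAt
    (fun x _ => hasDerivAt_gaussianPDFReal x) integrable_gaussianPDFReal_mul_id.integrableOn htend
  rw [← integral_indicator measurableSet_Ioi, integral_gaussianReal_eq_integral_smul one_ne_zero]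
  have e : (fun x => gaussianPDFReal 0 1 x • (Ioi t).indicator (fun x => x) x)
      = (Ioi t).indicator (fun x => gaussianPDFReal 0 1 x * x) := by
    ext x; by_cases hx : x ∈ Ioi t <;> simp [hx]
  rw [e, integral_indicator measurableSet_Ioi, h]; ring

/-- The two terms of x - y contribute γ(Iic t) φ(t) and γ(Ioi t) φ(t), and the two masses add up to
1. That the kernel reproduces the density is what makes the Poincaré constant equal to 1. -/
lemma lintegral_chernoff_kernel (t : ℝ) :
    ∫⁻ x in Ioi t, ∫⁻ y in Iic t, ENNReal.ofReal (x - y) ∂(gaussianReal 0 1) ∂(gaussianReal 0 1)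
      = gaussianPDF 0 1 t := by
  set γ := gaussianReal 0 1
  set φ := gaussianPDFReal 0 1 t
  have hφ : 0 ≤ φ := gaussianPDFReal_nonneg 0 1 t
  have hid : Integrable (fun x : ℝ => x) γ := IsGaussian.integrable_id
  have hIic : ∫ y in Iic t, y ∂γ = -φ := by
    have h := integral_add_compl (μ := γ) (measurableSet_Ioi (a := t)) hid
    rw [setIntegral_Ioi_id_gaussianReal, compl_Ioi,
      show ∫ x, x ∂γ = 0 from integral_id_gaussianReal] at h
    linarith
  have inner : ∀ x ∈ Ioi t, ∫⁻ y in Iic t, ENNReal.ofReal (x - y) ∂γ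
      = ENNReal.ofReal (γ.real (Iic t) * x + φ) := by
    intro x hx
    rw [← ofReal_integral_eq_lintegral_ofReal]
    · rw [integral_sub (integrable_const _) hid.integrableOn, hIic]
      simp
    · exact (integrable_const _).sub hid.integrableOn
    · filter_upwards [ae_restrict_mem measurableSet_Iic] with y hy
      have h1 : y ≤ t := hy
      have h2 : t < x := hx
      simp only [Pi.zero_apply]; linarith
  have hnn : ∀ x ∈ Ioi t, 0 ≤ γ.real (Iic t) * x + φ := by
    intro x hx
    have h : 0 ≤ ∫ y in Iic t, (x - y) ∂γ := by
      refine setIntegral_nonneg measurableSet_Iic fun y hy => ?_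
      have h1 : y ≤ t := hy
      have h2 : t < x := hx
      linarith
    rw [integral_sub (integrable_const _) hid.integrableOn, hIic] at h
    simpa using h
  rw [setLIntegral_congr_fun measurableSet_Ioi inner, ← ofReal_integral_eq_lintegral_ofReal]
  · rw [gaussianPDF]
    congr 1
    rw [integral_add (hid.integrableOn.const_mul _) (integrable_const _), integral_const_mul,
      setIntegral_Ioi_id_gaussianReal]
    have hc : γ.real (Ioi t) = 1 - γ.real (Iic t) := by
      rw [← compl_Iic, probReal_compl_eq_one_sub measurableSet_Iic]
    simp only [integral_const, MeasurableSet.univ, measureReal_restrict_apply, univ_inter, smul_eq_mul, hc]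
    ring
  · exact (hid.integrableOn.const_mul _).add (integrable_const _)
  · filter_upwards [ae_restrict_mem measurableSet_Ioi] with x hx
    exact hnn x hx

/-- **Chernoff's inequality**: the Poincaré inequality for the standard Gaussian on the line. -/
theorem gaussianReal_poincare {K : NNReal} {f : ℝ → ℝ} (hf : LipschitzWith K f) :
    ∫ x, f x ^ 2 ∂(gaussianReal 0 1) - (∫ x, f x ∂(gaussianReal 0 1)) ^ 2
      ≤ ∫ x, (deriv f x) ^ 2 ∂(gaussianReal 0 1) := by
  set γ := gaussianReal 0 1
  set g : ℝ → ENNReal := fun t => ENNReal.ofReal ((deriv f t) ^ 2) with hg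
  have hgm : Measurable g := ((measurable_deriv f).pow_const 2).ennreal_ofReal
  have hL2 : MemLp f 2 γ := by
    have hid : MemLp (fun x : ℝ => x) 2 γ := memLp_id_gaussianReal 2
    have hdom : MemLp (fun x : ℝ => ‖f 0‖ + K * ‖x‖) 2 γ :=
      (memLp_const ‖f 0‖).add (hid.norm.const_mul (K : ℝ))
    refine hdom.mono hf.continuous.aestronglyMeasurable (Eventually.of_forall fun x => ?_)
    have h1 := hf.dist_le_mul x 0
    rw [dist_eq_norm, dist_zero_right] at h1
    have h2 : ‖f x‖ ≤ ‖f 0‖ + ‖f x - f 0‖ := by simpa using norm_add_le (f 0) (f x - f 0)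
    exact (h2.trans (by linarith)).trans (le_abs_self _)
  -- The kernel records that t lies between y and x, with weight x - y; for fixed t, Tonelli then
  -- integrates out x and y.
  let k : ℝ → ℝ → ℝ → ENNReal := fun x y t =>
    (Ioi t).indicator 1 x * ((Iic t).indicator 1 y * ENNReal.ofReal (x - y))
  have hkm : Measurable (fun p : (ℝ × ℝ) × ℝ => k p.1.1 p.1.2 p.2) := by
    have m1 : Measurable (fun p : (ℝ × ℝ) × ℝ => (Ioi p.2).indicator (1 : ℝ → ENNReal) p.1.1) := by
      have : (fun p : (ℝ × ℝ) × ℝ => (Ioi p.2).indicator (1 : ℝ → ENNReal) p.1.1)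
          = {p : (ℝ × ℝ) × ℝ | p.2 < p.1.1}.indicator 1 := by
        ext p; simp [indicator]
      rw [this]
      exact measurable_one.indicator (measurableSet_lt (by fun_prop) (by fun_prop))
    have m2 : Measurable (fun p : (ℝ × ℝ) × ℝ => (Iic p.2).indicator (1 : ℝ → ENNReal) p.1.2) := by
      have : (fun p : (ℝ × ℝ) × ℝ => (Iic p.2).indicator (1 : ℝ → ENNReal) p.1.2)
          = {p : (ℝ × ℝ) × ℝ | p.1.2 ≤ p.2}.indicator 1 := by
        ext p; simp [indicator]
      rw [this]
      exact measurable_one.indicator (measurableSet_le (by fun_prop) (by fun_prop))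
    exact m1.mul (m2.mul (by fun_prop))
  have key : ∀ x y, y ≤ x → ENNReal.ofReal ((f x - f y) ^ 2) ≤ ∫⁻ t, k x y t * g t := by
    intro x y hyx
    refine (ENNReal.ofReal_le_ofReal (hf.sub_sq_le_mul_integral_deriv_sq hyx)).trans ?_
    rw [ENNReal.ofReal_mul (sub_nonneg.mpr hyx), intervalIntegral.integral_of_le hyx]
    have hE : ENNReal.ofReal (∫ t in Ioc y x, deriv f t ^ 2) ≤ ∫⁻ t in Ioc y x, g t := by
      rw [integral_eq_lintegral_of_nonneg_ae (Eventually.of_forall fun t => sq_nonneg _)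
        ((measurable_deriv f).pow_const 2).aestronglyMeasurable]
      exact ENNReal.ofReal_toReal_le
    refine (mul_le_mul_right hE _).trans ?_
    rw [← lintegral_const_mul _ hgm, ← lintegral_indicator measurableSet_Ioc,
      lintegral_congr_ae]
    -- The kernel and the interval `Ioc y x` treat the endpoints differently, which is negligible.
    have hne : ∀ᵐ t : ℝ, t ≠ x ∧ t ≠ y := by
      have h1 := (countable_singleton x).ae_notMem (volume : Measure ℝ)
      have h2 := (countable_singleton y).ae_notMem (volume : Measure ℝ)
      filter_upwards [h1, h2] with t h1 h2
      exact ⟨h1, h2⟩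
    filter_upwards [hne] with t ht
    by_cases h1 : y < t
    · by_cases h2 : t < x
      · simp [k, h1, h2, h1.le, h2.le]
      · have h3 : ¬ t ≤ x := fun h => h2 (lt_of_le_of_ne h ht.1)
        simp [k, h2, h3]
    · have h3 : ¬ y ≤ t := fun h => h1 (lt_of_le_of_ne h ht.2.symm)
      simp [k, h1, h3]
  -- Adding the kernel with x and y exchanged covers both orders; the resulting factor 2 cancels the
  -- one in `integral_prod_sub_sq`.
  have key2 : ∀ p : ℝ × ℝ, ENNReal.ofReal ((f p.1 - f p.2) ^ 2)
      ≤ ∫⁻ t, (k p.1 p.2 t + k p.2 p.1 t) * g t := by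
    rintro ⟨x, y⟩
    rcases le_total y x with h | h
    · refine (key x y h).trans (lintegral_mono fun t => ?_)
      gcongr; exact le_self_add
    · have := key y x h
      rw [show (f y - f x) ^ 2 = (f x - f y) ^ 2 by ring] at this
      refine this.trans (lintegral_mono fun t => ?_)
      gcongr; exact le_add_self
  have hK : ∀ t, ∫⁻ x, ∫⁻ y, k x y t ∂γ ∂γ = gaussianPDF 0 1 t := by
    intro t
    rw [← lintegral_chernoff_kernel t, ← lintegral_indicator measurableSet_Ioi]
    refine lintegral_congr fun x => ?_
    have e : ∀ y, (Iic t).indicator (1 : ℝ → ENNReal) y * ENNReal.ofReal (x - y)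
        = (Iic t).indicator (fun y => ENNReal.ofReal (x - y)) y := by
      intro y; by_cases hy : y ∈ Iic t <;> simp [hy]
    simp only [k, e]
    by_cases hx : x ∈ Ioi t
    · rw [indicator_of_mem hx, indicator_of_mem hx, ← lintegral_indicator measurableSet_Iic]
      simp; rfl
    · rw [indicator_of_notMem hx, indicator_of_notMem hx]; simp
  have hk1 : ∀ t, Measurable fun p : ℝ × ℝ => k p.1 p.2 t := fun t =>
    hkm.comp (by fun_prop : Measurable fun p : ℝ × ℝ => (p, t))
  have hk2 : ∀ t, Measurable fun p : ℝ × ℝ => k p.2 p.1 t := fun t =>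
    hkm.comp (by fun_prop : Measurable fun p : ℝ × ℝ => (p.swap, t))
  have hKp : ∀ t, ∫⁻ p : ℝ × ℝ, (k p.1 p.2 t + k p.2 p.1 t) ∂(γ.prod γ) = 2 * gaussianPDF 0 1 t := by
    intro t
    rw [lintegral_add_left (hk1 t), lintegral_prod _ (hk1 t).aemeasurable,
      lintegral_prod_symm _ (hk2 t).aemeasurable, hK t, two_mul]
  have main : ∫⁻ p, ENNReal.ofReal ((f p.1 - f p.2) ^ 2) ∂(γ.prod γ) ≤ 2 * ∫⁻ t, g t ∂γ := by
    calc ∫⁻ p, ENNReal.ofReal ((f p.1 - f p.2) ^ 2) ∂(γ.prod γ)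
        ≤ ∫⁻ p, ∫⁻ t, (k p.1 p.2 t + k p.2 p.1 t) * g t ∂volume ∂(γ.prod γ) := lintegral_mono key2
      _ = ∫⁻ t, ∫⁻ p, (k p.1 p.2 t + k p.2 p.1 t) * g t ∂(γ.prod γ) ∂volume := by
          refine lintegral_lintegral_swap (Measurable.aemeasurable ?_)
          refine Measurable.mul (Measurable.add hkm (hkm.comp
            (by fun_prop : Measurable fun p : (ℝ × ℝ) × ℝ => (p.1.swap, p.2))))
            (hgm.comp measurable_snd)
      _ = ∫⁻ t, 2 * (gaussianPDF 0 1 t * g t) := by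
          refine lintegral_congr fun t => ?_
          have hm : Measurable fun p : ℝ × ℝ => k p.1 p.2 t + k p.2 p.1 t := (hk1 t).add (hk2 t)
          rw [lintegral_mul_const _ hm, hKp t, mul_assoc]
      _ = 2 * ∫⁻ t, g t ∂γ := by
          have hm : Measurable fun t => gaussianPDF 0 1 t * g t := (measurable_gaussianPDF 0 1).mul hgm
          rw [lintegral_const_mul _ hm]
          simp only [γ]
          rw [gaussianReal_of_var_ne_zero _ one_ne_zero,
            lintegral_withDensity_eq_lintegral_mul _ (measurable_gaussianPDF 0 1) hgm]
          rfl
  obtain ⟨hint, heq⟩ := integral_prod_sub_sq hL2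
  have hgi : Integrable (fun t => (deriv f t) ^ 2) γ := by
    refine Integrable.of_bound ((measurable_deriv f).pow_const 2).aestronglyMeasurable ((K : ℝ) ^ 2)
      (Eventually.of_forall fun t => ?_)
    simp only [norm_pow]
    exact pow_le_pow_left₀ (norm_nonneg _) (norm_deriv_le_of_lipschitz hf) 2
  rw [← ofReal_integral_eq_lintegral_ofReal hint (Eventually.of_forall fun p => sq_nonneg _), heq,
    ← ofReal_integral_eq_lintegral_ofReal hgi (Eventually.of_forall fun p => sq_nonneg _),
    ← ENNReal.ofReal_ofNat 2, ← ENNReal.ofReal_mul (by norm_num)] at main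
  have hnn : 0 ≤ ∫ t, (deriv f t) ^ 2 ∂γ := integral_nonneg fun t => sq_nonneg _
  have := (ENNReal.ofReal_le_ofReal_iff (by positivity)).mp main
  linarith

end GaussianLine

/-! ### Homogeneous extensions of functions on the sphere -/

section Homogeneous

open Set Measure Filter Topology

variable {n : ℕ}

lemma homogeneousExtension_smul (u : UnitSphere n → ℝ) {s : ℝ} (hs : 0 < s) (x : UnitSphere n) :
    homogeneousExtension u (s • (x : EuclideanSpace ℝ (Fin n))) = u x := by
  have hx : ‖(x : EuclideanSpace ℝ (Fin n))‖ = 1 := by simp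
  have hx0 : (x : EuclideanSpace ℝ (Fin n)) ≠ 0 := by
    intro h; rw [h] at hx; simp at hx
  rw [homogeneousExtension, dif_pos (smul_ne_zero hs.ne' hx0)]
  congr 1
  ext1
  simp only [norm_smul, hx, mul_one, Real.norm_of_nonneg hs.le, smul_smul, inv_mul_cancel₀ hs.ne',
    one_smul]

lemma homogeneousExtension_coe (u : UnitSphere n → ℝ) (x : UnitSphere n) :
    homogeneousExtension u (x : EuclideanSpace ℝ (Fin n)) = u x := by
  simpa using homogeneousExtension_smul u one_pos x

lemma homogeneousExtension_smul_left (u : UnitSphere n → ℝ) {s : ℝ} (hs : 0 < s)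
    (y : EuclideanSpace ℝ (Fin n)) :
    homogeneousExtension u (s • y) = homogeneousExtension u y := by
  by_cases hy : y = 0
  · simp [hy]
  · rw [homogeneousExtension, homogeneousExtension, dif_pos (smul_ne_zero hs.ne' hy), dif_pos hy]
    congr 1
    ext1
    simp only [norm_smul, Real.norm_of_nonneg hs.le, smul_smul, mul_inv]
    congr 1
    field_simp

/-- Every nonzero vector is a positive multiple of a point of the sphere. -/
lemma exists_smul_sphere {y : EuclideanSpace ℝ (Fin n)} (hy : y ≠ 0) :
    ∃ x : UnitSphere n, y = ‖y‖ • (x : EuclideanSpace ℝ (Fin n)) := by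
  refine ⟨⟨‖y‖⁻¹ • y, by simp [norm_smul, inv_mul_cancel₀ (norm_ne_zero_iff.mpr hy)]⟩, ?_⟩
  simp [smul_smul, mul_inv_cancel₀ (norm_ne_zero_iff.mpr hy)]

/-- The extension of a function on the sphere that is homogeneous of degree `1`. -/
noncomputable def oneHom (v : UnitSphere n → ℝ) (y : EuclideanSpace ℝ (Fin n)) : ℝ :=
  ‖y‖ * homogeneousExtension v y

lemma oneHom_smul (v : UnitSphere n → ℝ) {s : ℝ} (hs : 0 ≤ s) (x : UnitSphere n) :
    oneHom v (s • (x : EuclideanSpace ℝ (Fin n))) = s * v x := by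
  rcases hs.eq_or_lt with rfl | hs
  · simp [oneHom]
  · rw [oneHom, homogeneousExtension_smul v hs]
    simp [norm_smul, abs_of_pos hs]

lemma oneHom_zero (v : UnitSphere n → ℝ) : oneHom v 0 = 0 := by simp [oneHom]

lemma exists_bound_of_lipschitz {v : UnitSphere n → ℝ} {K : NNReal} (hv : LipschitzWith K v) :
    ∃ C : NNReal, ∀ x, |v x| ≤ C := by
  obtain ⟨C, hC⟩ := isCompact_univ.exists_bound_of_continuousOn hv.continuous.continuousOn
  refine ⟨C.toNNReal, fun x => (hC x (mem_univ x)).trans (Real.le_coe_toNNReal C)⟩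

/-- The factor ‖y‖ compensates the 1/‖y‖ blow-up of the gradient of the degree-0 extension. Degree 1
thus gives a globally Lipschitz function on ℝⁿ, to which Rademacher's theorem, integration by parts
and the Gaussian inequality apply. -/
lemma exists_lipschitzWith_oneHom {v : UnitSphere n → ℝ} {K : NNReal} (hv : LipschitzWith K v) :
    ∃ K', LipschitzWith K' (oneHom v) := by
  obtain ⟨C, hC⟩ := exists_bound_of_lipschitz hv
  refine ⟨C + 2 * K, LipschitzWith.of_dist_le_mul fun y z => ?_⟩
  have hbd : ∀ z, |oneHom v z| ≤ C * ‖z‖ := by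
    intro z
    by_cases hz : z = 0
    · simp [hz, oneHom]
    · obtain ⟨x, hx⟩ := exists_smul_sphere hz
      rw [hx, oneHom_smul v (norm_nonneg z), abs_mul, abs_norm, ← hx, mul_comm]
      exact mul_le_mul_of_nonneg_right (hC x) (norm_nonneg z)
  have hle : (C : ℝ) ≤ ((C + 2 * K : NNReal) : ℝ) := by
    push_cast; linarith [K.coe_nonneg]
  by_cases hy : y = 0
  · rw [hy, oneHom_zero, dist_comm, Real.dist_eq, sub_zero, dist_zero_left]
    exact (hbd z).trans (mul_le_mul_of_nonneg_right hle (norm_nonneg z))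
  by_cases hz : z = 0
  · rw [hz, oneHom_zero, Real.dist_eq, sub_zero, dist_zero_right]
    exact (hbd y).trans (mul_le_mul_of_nonneg_right hle (norm_nonneg y))
  obtain ⟨a, ha⟩ := exists_smul_sphere hy
  obtain ⟨b, hb⟩ := exists_smul_sphere hz
  set s := ‖y‖
  set t := ‖z‖
  have hna : ‖(a : EuclideanSpace ℝ (Fin n))‖ = 1 := by simp
  have hst : |s - t| ≤ dist y z := by rw [dist_eq_norm]; exact abs_norm_sub_norm_le y z
  -- The angular displacement is y - z minus its radial part, and each of these has norm at most
  -- `dist y z`.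
  have hab : t * dist a b ≤ 2 * dist y z := by
    have e : t • ((a : EuclideanSpace ℝ (Fin n)) - b) = (y - z) - (s - t) • (a : EuclideanSpace ℝ (Fin n)) := by
      rw [ha, hb]; module
    calc t * dist a b = ‖t • ((a : EuclideanSpace ℝ (Fin n)) - b)‖ := by
          rw [norm_smul, Real.norm_of_nonneg (norm_nonneg z), Subtype.dist_eq, dist_eq_norm]
      _ ≤ ‖y - z‖ + ‖(s - t) • (a : EuclideanSpace ℝ (Fin n))‖ := by rw [e]; exact norm_sub_le _ _
      _ ≤ dist y z + dist y z := by
          rw [norm_smul, hna, mul_one, ← dist_eq_norm, Real.norm_eq_abs]; linarith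
      _ = 2 * dist y z := by ring
  have h1 : oneHom v y = s * v a := by rw [ha]; exact oneHom_smul v (norm_nonneg y) a
  have h2 : oneHom v z = t * v b := by rw [hb]; exact oneHom_smul v (norm_nonneg z) b
  have h3 := hv.dist_le_mul a b
  rw [Real.dist_eq] at h3
  have ht : 0 ≤ t := norm_nonneg z
  rw [h1, h2, Real.dist_eq]
  calc |s * v a - t * v b| = |(s - t) * v a + t * (v a - v b)| := by ring_nf
    _ ≤ |s - t| * |v a| + t * |v a - v b| := by
        refine (abs_add_le _ _).trans ?_
        rw [abs_mul, abs_mul, abs_of_nonneg ht]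
    _ ≤ dist y z * C + t * (K * dist a b) := by
        gcongr; exact hC a
    _ = dist y z * C + K * (t * dist a b) := by ring
    _ ≤ dist y z * C + K * (2 * dist y z) := by gcongr
    _ = ((C + 2 * K : NNReal) : ℝ) * dist y z := by push_cast; ring

lemma homogeneousExtension_eq_div (v : UnitSphere n → ℝ) {y : EuclideanSpace ℝ (Fin n)} (hy : y ≠ 0) :
    homogeneousExtension v y = oneHom v y / ‖y‖ := by
  rw [oneHom, mul_div_cancel_left₀ _ (norm_ne_zero_iff.mpr hy)]

lemma differentiableAt_homogeneousExtension_of_smul {v : UnitSphere n → ℝ} {s : ℝ} (hs : 0 < s)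
    {y : EuclideanSpace ℝ (Fin n)} (h : DifferentiableAt ℝ (homogeneousExtension v) (s • y)) :
    DifferentiableAt ℝ (homogeneousExtension v) y := by
  have : homogeneousExtension v = fun y => homogeneousExtension v (s • y) := by
    ext y; rw [homogeneousExtension_smul_left v hs]
  rw [this]
  exact DifferentiableAt.comp y h (by fun_prop)

/-- Rademacher's theorem on the sphere. -/
lemma ae_differentiableAt_homogeneousExtension [NeZero n] {v : UnitSphere n → ℝ} {K : NNReal}
    (hv : LipschitzWith K v) :
    ∀ᵐ x : UnitSphere n ∂(surfaceMeasure n),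
      DifferentiableAt ℝ (homogeneousExtension v) (x : EuclideanSpace ℝ (Fin n)) := by
  obtain ⟨K', hK'⟩ := exists_lipschitzWith_oneHom hv
  -- The sphere is null in ℝⁿ, so Rademacher says nothing about it directly. Almost every ray
  -- however contains a point of differentiability, and homogeneity carries it to the sphere.
  filter_upwards [ae_ae_polar hK'.ae_differentiableAt] with x hx
  obtain ⟨s, hs, hd⟩ := exists_pos_of_ae_Ioi hx
  refine differentiableAt_homogeneousExtension_of_smul hs ?_
  have hx0 : s • (x : EuclideanSpace ℝ (Fin n)) ≠ 0 := by
    refine smul_ne_zero hs.ne' fun h => ?_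
    have : ‖(x : EuclideanSpace ℝ (Fin n))‖ = 1 := by simp
    rw [h] at this; simp at this
  have : homogeneousExtension v =ᶠ[𝓝 (s • (x : EuclideanSpace ℝ (Fin n)))] fun y => oneHom v y / ‖y‖ := by
    filter_upwards [isOpen_ne.mem_nhds hx0] with y hy
    exact homogeneousExtension_eq_div v hy
  refine DifferentiableAt.congr_of_eventuallyEq ?_ this
  have hn : DifferentiableAt ℝ (fun y : EuclideanSpace ℝ (Fin n) => ‖y‖)
      (s • (x : EuclideanSpace ℝ (Fin n))) :=
    DifferentiableAt.norm (f := fun y => y) ℝ differentiableAt_fun_id hx0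
  simp only [div_eq_mul_inv]
  exact hd.fun_mul (hn.fun_inv (norm_ne_zero_iff.mpr hx0))

lemma hasGradientAt_homogeneousExtension {v : UnitSphere n → ℝ} {x : UnitSphere n}
    (h : DifferentiableAt ℝ (homogeneousExtension v) (x : EuclideanSpace ℝ (Fin n))) :
    HasGradientAt (homogeneousExtension v) (tangentialGradient v x) (x : EuclideanSpace ℝ (Fin n)) :=
  h.hasGradientAt

/-- The extension is constant along the ray through x, so its radial derivative vanishes; where it
is not differentiable the gradient is 0 by convention. -/
lemma inner_tangentialGradient (v : UnitSphere n → ℝ) (x : UnitSphere n) :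
    inner ℝ (x : EuclideanSpace ℝ (Fin n)) (tangentialGradient v x) = 0 := by
  by_cases h : DifferentiableAt ℝ (homogeneousExtension v) (x : EuclideanSpace ℝ (Fin n))
  · have h1 := (hasGradientAt_homogeneousExtension h).hasFDerivAt
    have h2 : HasDerivAt (fun s : ℝ => s • (x : EuclideanSpace ℝ (Fin n))) (x : EuclideanSpace ℝ (Fin n)) 1 := by
      simpa using (hasDerivAt_id (1 : ℝ)).smul_const (x : EuclideanSpace ℝ (Fin n))
    rw [← one_smul ℝ (x : EuclideanSpace ℝ (Fin n))] at h1
    have h3 := h1.comp_hasDerivAt (1 : ℝ) h2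
    have h4 : HasDerivAt (homogeneousExtension v ∘ fun s : ℝ => s • (x : EuclideanSpace ℝ (Fin n))) 0 1 := by
      refine (hasDerivAt_const (1 : ℝ) (v x)).congr_of_eventuallyEq ?_
      filter_upwards [lt_mem_nhds (zero_lt_one' ℝ)] with s hs
      exact homogeneousExtension_smul v hs x
    have h5 := h3.unique h4
    rw [real_inner_comm]
    simpa using h5
  · rw [tangentialGradient, gradient_eq_zero_of_not_differentiableAt h, inner_zero_right]

/-- The gradient of the extension of degree `1`, along the whole ray. -/
lemma hasGradientAt_oneHom {v : UnitSphere n → ℝ} {x : UnitSphere n}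
    (h : DifferentiableAt ℝ (homogeneousExtension v) (x : EuclideanSpace ℝ (Fin n)))
    {s : ℝ} (hs : 0 < s) :
    HasGradientAt (oneHom v) (v x • (x : EuclideanSpace ℝ (Fin n)) + tangentialGradient v x)
      (s • (x : EuclideanSpace ℝ (Fin n))) := by
  set X := (x : EuclideanSpace ℝ (Fin n))
  have hX : ‖X‖ = 1 := by simp [X]
  have hX0 : X ≠ 0 := by intro h; rw [h] at hX; simp at hX
  have h1 := (hasGradientAt_homogeneousExtension h).hasFDerivAt
  have h2 : HasFDerivAt (fun y : EuclideanSpace ℝ (Fin n) => ‖y‖) (innerSL ℝ X) X := by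
    have := (hasStrictFDerivAt_norm_sq X).hasFDerivAt.sqrt (by simp [hX])
    simp only [Real.sqrt_sq (norm_nonneg _), hX] at this
    convert! this using 1
    ext y; simp
  have h3 : HasFDerivAt (oneHom v) (InnerProductSpace.toDual ℝ (EuclideanSpace ℝ (Fin n))
      (v x • X + tangentialGradient v x)) X := by
    have := h2.mul h1
    convert! this using 1
    ext y
    simp [X, homogeneousExtension_coe]
    ring
  -- Degree 1 makes the gradient constant along rays: it is computed on the sphere and transported
  -- by rescaling.
  have h4 : oneHom v = fun y => s * oneHom v (s⁻¹ • y) := by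
    ext y
    rw [oneHom, oneHom, homogeneousExtension_smul_left v (inv_pos.mpr hs), norm_smul, norm_inv,
      Real.norm_of_nonneg hs.le]
    field_simp
  rw [hasGradientAt_iff_hasFDerivAt, h4]
  have h5 : HasFDerivAt (fun y : EuclideanSpace ℝ (Fin n) => s⁻¹ • y)
      (s⁻¹ • ContinuousLinearMap.id ℝ (EuclideanSpace ℝ (Fin n))) (s • X) :=
    (hasFDerivAt_id _).const_smul s⁻¹
  have h6 : X = s⁻¹ • (s • X) := by rw [smul_smul, inv_mul_cancel₀ hs.ne', one_smul]
  nth_rewrite 2 [h6] at h3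
  have h7 := (h3.comp (s • X) h5).const_mul s
  convert! h7 using 1
  ext y
  simp
  field_simp

lemma norm_sq_add_tangentialGradient (v : UnitSphere n → ℝ) (x : UnitSphere n) (a : ℝ) :
    ‖a • (x : EuclideanSpace ℝ (Fin n)) + tangentialGradient v x‖ ^ 2
      = a ^ 2 + ‖tangentialGradient v x‖ ^ 2 := by
  have hx : ‖(x : EuclideanSpace ℝ (Fin n))‖ = 1 := by simp
  rw [norm_add_sq_real, inner_smul_left, inner_tangentialGradient, norm_smul, hx]
  simp

/-- The chain rule for the tangential gradient. -/
lemma tangentialGradient_comp {v : UnitSphere n → ℝ} {x : UnitSphere n}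
    (h : DifferentiableAt ℝ (homogeneousExtension v) (x : EuclideanSpace ℝ (Fin n)))
    {f : ℝ → ℝ} {f' : ℝ} (hf : HasDerivAt f f' (v x)) :
    tangentialGradient (fun x => f (v x)) x = f' • tangentialGradient v x
      ∧ DifferentiableAt ℝ (homogeneousExtension fun x => f (v x)) (x : EuclideanSpace ℝ (Fin n)) := by
  set X := (x : EuclideanSpace ℝ (Fin n))
  have hX : ‖X‖ = 1 := by simp [X]
  have hX0 : X ≠ 0 := by intro h; rw [h] at hX; simp at hX
  have h1 := (hasGradientAt_homogeneousExtension h).hasFDerivAt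
  have h2 : HasDerivAt f f' (homogeneousExtension v X) := by rwa [homogeneousExtension_coe]
  have h3 := h2.comp_hasFDerivAt X h1
  have h4 : homogeneousExtension (fun x => f (v x)) =ᶠ[𝓝 X] f ∘ homogeneousExtension v := by
    filter_upwards [isOpen_ne.mem_nhds hX0] with y hy
    simp only [homogeneousExtension, Function.comp_apply, dif_pos hy]
  have h5 : HasGradientAt (homogeneousExtension fun x => f (v x)) (f' • tangentialGradient v x) X := by
    rw [hasGradientAt_iff_hasFDerivAt]
    convert! h3.congr_of_eventuallyEq h4 using 1
    ext y; simp
  exact ⟨h5.gradient, h5.differentiableAt⟩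

lemma measurable_gradient_euclidean (f : EuclideanSpace ℝ (Fin n) → ℝ) : Measurable (gradient f) := by
  unfold gradient
  exact (InnerProductSpace.toDual ℝ (EuclideanSpace ℝ (Fin n))).symm.continuous.measurable.comp
    (measurable_fderiv ℝ f)

lemma measurable_tangentialGradient (v : UnitSphere n → ℝ) : Measurable (tangentialGradient v) :=
  (measurable_gradient_euclidean _).comp measurable_subtype_coe

lemma norm_gradient_le_of_lipschitz {f : EuclideanSpace ℝ (Fin n) → ℝ} {K : NNReal}
    (hf : LipschitzWith K f) (x : EuclideanSpace ℝ (Fin n)) : ‖gradient f x‖ ≤ K := by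
  rw [gradient, LinearIsometryEquiv.norm_map]
  exact norm_fderiv_le_of_lipschitz ℝ hf

/-- Both `v` and `∇_τ v` are dominated by the Lipschitz constant of the extension. -/
lemma exists_bound_tangentialGradient [NeZero n] {v : UnitSphere n → ℝ} {K : NNReal}
    (hv : LipschitzWith K v) :
    ∃ C : ℝ, 0 ≤ C ∧ ∀ᵐ x ∂(surfaceMeasure n), ‖tangentialGradient v x‖ ≤ C := by
  obtain ⟨K', hK'⟩ := exists_lipschitzWith_oneHom hv
  refine ⟨K', K'.coe_nonneg, ?_⟩
  filter_upwards [ae_differentiableAt_homogeneousExtension hv] with x hx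
  have h1 := norm_gradient_le_of_lipschitz hK' ((1 : ℝ) • (x : EuclideanSpace ℝ (Fin n)))
  rw [(hasGradientAt_oneHom hx one_pos).gradient] at h1
  have h2 := norm_sq_add_tangentialGradient v x (v x)
  refine le_trans ?_ h1
  refine le_of_sq_le_sq ?_ (norm_nonneg _)
  rw [h2]
  nlinarith [sq_nonneg (v x)]

end Homogeneous

/-! ### The Gaussian Poincaré inequality in `ℝⁿ` -/

section GaussianProduct

open Set Measure Filter Topology ProbabilityTheory

lemma sq_integral_le_integral_sq {α : Type*} [MeasurableSpace α] {μ : Measure α}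
    [IsProbabilityMeasure μ] {f : α → ℝ} (hf : MemLp f 2 μ) :
    (∫ x, f x ∂μ) ^ 2 ≤ ∫ x, f x ^ 2 ∂μ := by
  have h := (integral_prod_sub_sq hf).2
  have h2 : 0 ≤ ∫ p, (f p.1 - f p.2) ^ 2 ∂(μ.prod μ) := integral_nonneg fun p => sq_nonneg _
  linarith

section Prod

variable {α β : Type*} [MeasurableSpace α] [MeasurableSpace β] {μ : Measure α} {ν : Measure β}
  [IsProbabilityMeasure μ] [IsProbabilityMeasure ν] {F : α × β → ℝ}

lemma MemLp.prod_right_section (hF : MemLp F 2 (μ.prod ν)) :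
    ∀ᵐ x ∂μ, MemLp (fun y => F (x, y)) 2 ν := by
  filter_upwards [hF.integrable_sq.prod_right_ae, hF.1.prodMk_left] with x h1 h2
  exact (memLp_two_iff_integrable_sq h2).mpr h1

lemma MemLp.integral_section (hF : MemLp F 2 (μ.prod ν)) :
    MemLp (fun x => ∫ y, F (x, y) ∂ν) 2 μ := by
  have hm : AEStronglyMeasurable (fun x => ∫ y, F (x, y) ∂ν) μ := hF.1.integral_prod_right'
  rw [memLp_two_iff_integrable_sq hm]
  refine Integrable.mono' hF.integrable_sq.integral_prod_left (hm.pow 2) ?_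
  filter_upwards [MemLp.prod_right_section hF] with x hx
  simpa using sq_integral_le_integral_sq hx

/-- The Efron–Stein inequality for two factors. -/
lemma integral_sq_section_add_le (hF : MemLp F 2 (μ.prod ν)) :
    ∫ x, (∫ y, F (x, y) ∂ν) ^ 2 ∂μ + ∫ y, (∫ x, F (x, y) ∂μ) ^ 2 ∂ν
      ≤ ∫ p, F p ^ 2 ∂(μ.prod ν) + (∫ p, F p ∂(μ.prod ν)) ^ 2 := by
  set M : α → ℝ := fun x => ∫ y, F (x, y) ∂ν
  set N : β → ℝ := fun y => ∫ x, F (x, y) ∂μ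
  have hswap : MemLp (F ∘ Prod.swap) 2 (ν.prod μ) := hF.comp_measurePreserving measurePreserving_swap
  have hM : MemLp M 2 μ := MemLp.integral_section hF
  have hN : MemLp N 2 ν := MemLp.integral_section hswap
  have hN' : MemLp (fun p : α × β => N p.2) 2 (μ.prod ν) := hN.comp_measurePreserving measurePreserving_snd
  have hG : MemLp (fun p : α × β => F p - N p.2) 2 (μ.prod ν) := hF.sub hN'
  set m := ∫ p, F p ∂(μ.prod ν)
  have hFi : Integrable F (μ.prod ν) := hF.integrable one_le_two
  have hmM : ∫ x, M x ∂μ = m := (integral_prod _ hFi).symm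
  have hmN : ∫ y, N y ∂ν = m := (integral_prod_symm _ hFi).symm
  have h1 : ∫ x, (M x - m) ^ 2 ∂μ = ∫ x, M x ^ 2 ∂μ - m ^ 2 := by
    have e : (fun x => (M x - m) ^ 2) = fun x => M x ^ 2 - 2 * m * M x + m ^ 2 := by ext x; ring
    have i1 : Integrable (fun x => M x ^ 2) μ := hM.integrable_sq
    have i2 : Integrable (fun x => 2 * m * M x) μ := (hM.integrable one_le_two).const_mul _
    have i3 : Integrable (fun x => M x ^ 2 - 2 * m * M x) μ := i1.sub i2
    rw [e, integral_add i3 (integrable_const _), integral_sub i1 i2, integral_const_mul, hmM]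
    simp; ring
  have h2 : ∫ p : α × β, (F p - N p.2) ^ 2 ∂(μ.prod ν) = ∫ p, F p ^ 2 ∂(μ.prod ν) - ∫ y, N y ^ 2 ∂ν := by
    have e : (fun p : α × β => (F p - N p.2) ^ 2)
        = fun p => F p ^ 2 - 2 * (F p * N p.2) + N p.2 ^ 2 := by ext x; ring
    have i1 : Integrable (fun p => F p ^ 2) (μ.prod ν) := hF.integrable_sq
    have i0 : Integrable (fun p : α × β => F p * N p.2) (μ.prod ν) := hF.integrable_mul hN'
    have i2 : Integrable (fun p : α × β => 2 * (F p * N p.2)) (μ.prod ν) := i0.const_mul 2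
    have i3 : Integrable (fun p : α × β => F p ^ 2 - 2 * (F p * N p.2)) (μ.prod ν) := i1.sub i2
    have i4 : Integrable (fun p : α × β => N p.2 ^ 2) (μ.prod ν) := hN'.integrable_sq
    rw [e, integral_add i3 i4, integral_sub i1 i2, integral_const_mul, integral_prod_symm _ i0,
      integral_prod_symm _ i4]
    simp only [integral_mul_const, integral_const, probReal_univ, one_smul]
    have : ∀ y, (∫ x, F (x, y) ∂μ) * N y = N y ^ 2 := fun y => by simp only [N]; ring
    simp_rw [this]; ring
  -- For fixed x, M x - m is the average over y of F - N; Jensen on each section gives the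
  -- inequality, whose two sides are expanded in `h1` and `h2`.
  have h3 : ∫ x, (M x - m) ^ 2 ∂μ ≤ ∫ p : α × β, (F p - N p.2) ^ 2 ∂(μ.prod ν) := by
    rw [integral_prod _ hG.integrable_sq]
    refine integral_mono_ae (hM.sub (memLp_const m)).integrable_sq hG.integrable_sq.integral_prod_left ?_
    filter_upwards [MemLp.prod_right_section hG, MemLp.prod_right_section hF] with x hx hx2
    have := sq_integral_le_integral_sq hx
    rwa [integral_sub (hx2.integrable one_le_two) (hN.integrable one_le_two), hmN] at this
  linarith

/-- Tensorization of Poincaré inequalities. -/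
lemma poincare_prod (hF : MemLp F 2 (μ.prod ν)) {a b : α × β → ℝ}
    (ha : Integrable a (μ.prod ν)) (hb : Integrable b (μ.prod ν))
    (h1 : ∀ y, ∫ x, F (x, y) ^ 2 ∂μ - (∫ x, F (x, y) ∂μ) ^ 2 ≤ ∫ x, a (x, y) ∂μ)
    (h2 : ∀ x, ∫ y, F (x, y) ^ 2 ∂ν - (∫ y, F (x, y) ∂ν) ^ 2 ≤ ∫ y, b (x, y) ∂ν) :
    ∫ p, F p ^ 2 ∂(μ.prod ν) - (∫ p, F p ∂(μ.prod ν)) ^ 2 ≤ ∫ p, (a p + b p) ∂(μ.prod ν) := by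
  -- Efron–Stein bounds the variance by the sum of the two averaged conditional variances; `e1` and
  -- `e2` bound these by the hypotheses on sections.
  have hES := integral_sq_section_add_le hF
  have hswap : MemLp (F ∘ Prod.swap) 2 (ν.prod μ) := hF.comp_measurePreserving measurePreserving_swap
  have hM := (MemLp.integral_section hF).integrable_sq
  have hN := (MemLp.integral_section hswap).integrable_sq
  simp only [Function.comp_apply, Prod.swap_prod_mk] at hN
  have hF2 := hF.integrable_sq
  have e1 : ∫ p, F p ^ 2 ∂(μ.prod ν) - ∫ y, (∫ x, F (x, y) ∂μ) ^ 2 ∂ν ≤ ∫ p, a p ∂(μ.prod ν) := by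
    rw [integral_prod_symm _ hF2, integral_prod_symm _ ha, ← integral_sub hF2.integral_prod_right hN]
    exact integral_mono (hF2.integral_prod_right.sub hN) ha.integral_prod_right h1
  have e2 : ∫ p, F p ^ 2 ∂(μ.prod ν) - ∫ x, (∫ y, F (x, y) ∂ν) ^ 2 ∂μ ≤ ∫ p, b p ∂(μ.prod ν) := by
    rw [integral_prod _ hF2, integral_prod _ hb, ← integral_sub hF2.integral_prod_left hM]
    exact integral_mono (hF2.integral_prod_left.sub hM) hb.integral_prod_left h2
  rw [integral_add ha hb]
  linarith

end Prod

lemma LipschitzWith.memLp_two {E : Type*} [NormedAddCommGroup E]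
    [MeasurableSpace E] [BorelSpace E] {μ : Measure E} [IsFiniteMeasure μ]
    (hid : MemLp (fun x : E => x) 2 μ) {K : NNReal} {f : E → ℝ} (hf : LipschitzWith K f) :
    MemLp f 2 μ := by
  have hdom : MemLp (fun x : E => ‖f 0‖ + K * ‖x‖) 2 μ :=
    (memLp_const ‖f 0‖).add (hid.norm.const_mul (K : ℝ))
  refine hdom.mono hf.continuous.aestronglyMeasurable (Eventually.of_forall fun x => ?_)
  have h1 := hf.dist_le_mul x 0
  rw [dist_eq_norm, dist_zero_right] at h1
  have h2 : ‖f x‖ ≤ ‖f 0‖ + ‖f x - f 0‖ := by simpa using norm_add_le (f 0) (f x - f 0)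
  exact (h2.trans (by linarith)).trans (le_abs_self _)

lemma memLp_id_pi_gaussianReal (n : ℕ) :
    MemLp (fun x : Fin n → ℝ => x) 2 (Measure.pi fun _ => gaussianReal 0 1) := by
  refine memLp_pi_iff.mpr fun i => ?_
  exact (memLp_id_gaussianReal (μ := 0) (v := 1) 2).comp_measurePreserving (measurePreserving_eval _ i)

lemma measurePreserving_finCons {n : ℕ} (γ : Measure ℝ) [SigmaFinite γ] :
    MeasurePreserving (fun p : ℝ × (Fin n → ℝ) => (Fin.cons p.1 p.2 : Fin (n + 1) → ℝ))
      (γ.prod (Measure.pi fun _ => γ)) (Measure.pi fun _ => γ) := by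
  have h := (measurePreserving_piFinSuccAbove (n := n) (α := fun _ => ℝ) (fun _ => γ) 0).symm
  convert! h using 1
  ext p i
  simp

lemma measurableEmbedding_finCons {n : ℕ} :
    MeasurableEmbedding (fun p : ℝ × (Fin n → ℝ) => (Fin.cons p.1 p.2 : Fin (n + 1) → ℝ)) := by
  have h := (MeasurableEquiv.piFinSuccAbove (fun _ : Fin (n + 1) => ℝ) 0).symm.measurableEmbedding
  convert! h using 1
  ext p i
  simp

/-- Induction splitting off one coordinate, with constant 1 throughout. Line derivatives are
convenient because they restrict to coordinate slices at every point, with no exceptional set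
depending on the slice. -/
theorem pi_gaussianReal_poincare (n : ℕ) : ∀ {K : NNReal} {F : (Fin n → ℝ) → ℝ}, LipschitzWith K F →
    ∫ x, F x ^ 2 ∂(Measure.pi fun _ => gaussianReal 0 1)
        - (∫ x, F x ∂(Measure.pi fun _ => gaussianReal 0 1)) ^ 2
      ≤ ∫ x, ∑ i, (lineDeriv ℝ F x (Pi.single i 1)) ^ 2 ∂(Measure.pi fun _ => gaussianReal 0 1) := by
  induction n with
  | zero =>
    intro K F hF
    have : ∀ x, F x = F 0 := fun x => congrArg F (Subsingleton.elim _ _)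
    simp [this]
  | succ n ih =>
    intro K F hF
    set γ := gaussianReal 0 1
    set c : ℝ × (Fin n → ℝ) → (Fin (n + 1) → ℝ) := fun p => Fin.cons p.1 p.2
    have hc : MeasurePreserving c (γ.prod (Measure.pi fun _ => γ)) (Measure.pi fun _ => γ) :=
      measurePreserving_finCons γ
    have hce : MeasurableEmbedding c := measurableEmbedding_finCons
    have hFL : MemLp F 2 (Measure.pi fun _ => γ) := hF.memLp_two (memLp_id_pi_gaussianReal _)
    have hbd : ∀ x i, ‖(lineDeriv ℝ F x (Pi.single i 1)) ^ 2‖ ≤ (K : ℝ) ^ 2 := by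
      intro x i
      rw [norm_pow]
      refine pow_le_pow_left₀ (norm_nonneg _) ?_ 2
      have h1 : ‖(Pi.single i 1 : Fin (n + 1) → ℝ)‖ = 1 := by rw [Pi.norm_single, norm_one]
      simpa [h1] using norm_lineDeriv_le_of_lipschitz (x₀ := x) (v := Pi.single i 1) ℝ hF
    have hms : ∀ i, Measurable fun x => (lineDeriv ℝ F x (Pi.single i 1)) ^ 2 := fun i =>
      (measurable_lineDeriv hF.continuous).pow_const 2
    have hint : ∀ i, Integrable (fun p => (lineDeriv ℝ F (c p) (Pi.single i 1)) ^ 2)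
        (γ.prod (Measure.pi fun _ => γ)) := fun i =>
      Integrable.of_bound ((hms i).comp hc.measurable).aestronglyMeasurable ((K : ℝ) ^ 2)
        (Eventually.of_forall fun p => hbd _ i)
    have hlip1 : ∀ y, LipschitzWith K fun x : ℝ => F (c (x, y)) := by
      intro y
      have : LipschitzWith 1 fun x : ℝ => c (x, y) := by
        refine LipschitzWith.of_dist_le_mul fun x x' => ?_
        rw [NNReal.coe_one, one_mul, dist_pi_le_iff dist_nonneg]
        intro i
        refine Fin.cases ?_ (fun j => ?_) i <;> simp [c]
      exact (hF.comp this).weaken (by simp)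
    have hlip2 : ∀ x, LipschitzWith K fun y => F (c (x, y)) := by
      intro x
      have : LipschitzWith 1 fun y => c (x, y) := by
        refine LipschitzWith.of_dist_le_mul fun y y' => ?_
        rw [NNReal.coe_one, one_mul, dist_pi_le_iff dist_nonneg]
        intro i
        refine Fin.cases ?_ (fun j => ?_) i
        · simp [c]
        · simpa [c] using dist_le_pi_dist y y' j
      exact (hF.comp this).weaken (by simp)
    have hd1 : ∀ x y, deriv (fun x : ℝ => F (c (x, y))) x = lineDeriv ℝ F (c (x, y)) (Pi.single 0 1) := by
      intro x y
      rw [lineDeriv]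
      have e : (fun t : ℝ => F (c (x, y) + t • Pi.single 0 1)) = fun t => F (c (x + t, y)) := by
        ext t; congr 1; ext i
        refine Fin.cases ?_ (fun j => ?_) i <;> simp [c]
      rw [e, deriv_comp_const_add (f := fun x => F (c (x, y)))]
      simp
    have hd2 : ∀ x y i, lineDeriv ℝ (fun y => F (c (x, y))) y (Pi.single i 1)
        = lineDeriv ℝ F (c (x, y)) (Pi.single i.succ 1) := by
      intro x y i
      rw [lineDeriv, lineDeriv]
      congr 1
      ext t; congr 1; ext j
      refine Fin.cases ?_ (fun j => ?_) j
      · simp [c]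
      · simp [c, Pi.single_apply]
    have hS := integrable_finsetSum (Finset.univ : Finset (Fin n)) fun i _ => hint i.succ
    have key := poincare_prod (hFL.comp_measurePreserving hc) (hint 0) hS
      (fun y => by
        have := gaussianReal_poincare (hlip1 y)
        simp only [hd1] at this
        exact this)
      (fun x => by
        have := ih (hlip2 x)
        simp only [hd2] at this
        exact this)
    rw [← hc.integral_comp hce, ← hc.integral_comp hce, ← hc.integral_comp hce]
    refine key.trans (le_of_eq (integral_congr_ae (Eventually.of_forall fun p => ?_)))
    simp only
    rw [Fin.sum_univ_succ]

/-- The Lipschitz constant does not enter the inequality, so passing from the sup norm to the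
Euclidean norm costs nothing. -/
theorem stdGaussian_poincare {n : ℕ} {K : NNReal} {F : EuclideanSpace ℝ (Fin n) → ℝ}
    (hF : LipschitzWith K F) :
    ∫ x, F x ^ 2 ∂(stdGaussian (EuclideanSpace ℝ (Fin n)))
        - (∫ x, F x ∂(stdGaussian (EuclideanSpace ℝ (Fin n)))) ^ 2
      ≤ ∫ x, ∑ i, (lineDeriv ℝ F x (EuclideanSpace.single i 1)) ^ 2
          ∂(stdGaussian (EuclideanSpace ℝ (Fin n))) := by
  have he : MeasurableEmbedding (WithLp.toLp 2 : (Fin n → ℝ) → EuclideanSpace ℝ (Fin n)) :=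
    (MeasurableEquiv.toLp 2 (Fin n → ℝ)).measurableEmbedding
  rw [← map_pi_eq_stdGaussian, he.integral_map, he.integral_map, he.integral_map]
  obtain ⟨L, hL⟩ : ∃ L, LipschitzWith L (WithLp.toLp 2 : (Fin n → ℝ) → EuclideanSpace ℝ (Fin n)) :=
    ⟨_, PiLp.lipschitzWith_toLp 2 fun _ : Fin n => ℝ⟩
  have h := pi_gaussianReal_poincare n (hF.comp hL)
  exact h

end GaussianProduct

/-! ### The sharp Poincaré inequality on the sphere -/

section SpherePoincare

open Set Measure Filter Topology ProbabilityTheory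

variable {n : ℕ}

lemma integrable_exp_neg_norm_sq (n : ℕ) :
    Integrable (fun x : EuclideanSpace ℝ (Fin n) => Real.exp (-‖x‖ ^ 2 / 2)) := by
  have h := GaussianFourier.integrable_cexp_neg_mul_sq_norm_add (V := EuclideanSpace ℝ (Fin n))
    (b := (1 / 2 : ℂ)) (by norm_num) 0 0
  refine h.re.congr (Eventually.of_forall fun x => ?_)
  have : (-(1 / 2 : ℂ) * (‖x‖ : ℂ) ^ 2 + 0 * ((inner ℝ 0 x : ℝ) : ℂ)) = ((-‖x‖ ^ 2 / 2 : ℝ) : ℂ) := by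
    push_cast; ring
  simp only [this]
  rw [← Complex.ofReal_exp]
  exact Complex.ofReal_re _

lemma integral_exp_neg_norm_sq_pos (n : ℕ) :
    0 < ∫ x : EuclideanSpace ℝ (Fin n), Real.exp (-‖x‖ ^ 2 / 2) := by
  rw [integral_pos_iff_support_of_nonneg (fun x => (Real.exp_pos _).le) (integrable_exp_neg_norm_sq n)]
  have : Function.support (fun x : EuclideanSpace ℝ (Fin n) => Real.exp (-‖x‖ ^ 2 / 2)) = univ := by
    ext x; simp [Real.exp_ne_zero]
  rw [this]
  exact isOpen_univ.measure_pos _ univ_nonempty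

/-- The standard Gaussian measure has density proportional to `e^{-|x|²/2}`. -/
lemma stdGaussian_eq_withDensity (n : ℕ) :
    stdGaussian (EuclideanSpace ℝ (Fin n)) = volume.withDensity fun x => ENNReal.ofReal
      ((∫ x : EuclideanSpace ℝ (Fin n), Real.exp (-‖x‖ ^ 2 / 2))⁻¹ * Real.exp (-‖x‖ ^ 2 / 2)) := by
  set Z := ∫ x : EuclideanSpace ℝ (Fin n), Real.exp (-‖x‖ ^ 2 / 2) with hZ
  have hZ0 : 0 < Z := integral_exp_neg_norm_sq_pos n
  have hnn : ∀ x : EuclideanSpace ℝ (Fin n), 0 ≤ Z⁻¹ * Real.exp (-‖x‖ ^ 2 / 2) := fun x => by positivity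
  have hint := (integrable_exp_neg_norm_sq n).const_mul Z⁻¹
  have : IsFiniteMeasure (volume.withDensity fun x : EuclideanSpace ℝ (Fin n) => ENNReal.ofReal
      (Z⁻¹ * Real.exp (-‖x‖ ^ 2 / 2))) := isFiniteMeasure_withDensity_ofReal hint.2
  -- The constant of the Gaussian Fourier integral is identified with Z by evaluating at t = 0;
  -- equality of characteristic functions then identifies the measures.
  have hF : ∀ t : EuclideanSpace ℝ (Fin n),
      ∫ x : EuclideanSpace ℝ (Fin n), ((Real.exp (-‖x‖ ^ 2 / 2) : ℝ) : ℂ) * Complex.exp ((inner ℝ x t : ℝ) * Complex.I)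
      = Z * Complex.exp (-‖t‖ ^ 2 / 2) := by
    have h : ∀ t : EuclideanSpace ℝ (Fin n),
        ∫ x : EuclideanSpace ℝ (Fin n), ((Real.exp (-‖x‖ ^ 2 / 2) : ℝ) : ℂ) * Complex.exp ((inner ℝ x t : ℝ) * Complex.I)
        = (Real.pi / (1 / 2 : ℂ)) ^ (Module.finrank ℝ (EuclideanSpace ℝ (Fin n)) / 2 : ℂ)
          * Complex.exp (-‖t‖ ^ 2 / 2) := by
      intro t
      have h := GaussianFourier.integral_cexp_neg_mul_sq_norm_add (V := EuclideanSpace ℝ (Fin n))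
        (b := (1 / 2 : ℂ)) (by norm_num) Complex.I t
      rw [show Complex.I ^ 2 * (‖t‖ : ℂ) ^ 2 / (4 * (1 / 2)) = -‖t‖ ^ 2 / 2 by
        rw [Complex.I_sq]; ring] at h
      rw [← h]
      refine integral_congr_ae (Eventually.of_forall fun x => ?_)
      simp only [Complex.ofReal_exp, ← Complex.exp_add]
      congr 1
      rw [real_inner_comm]
      push_cast; ring
    have h0 := h 0
    simp only [inner_zero_right, Complex.ofReal_zero, zero_mul, Complex.exp_zero, mul_one, norm_zero] at h0
    rw [integral_complex_ofReal] at h0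
    intro t
    rw [h t, hZ, h0]
    simp
  refine Measure.ext_of_charFun ?_
  ext t
  rw [charFun_stdGaussian, charFun_apply]
  have e : ∫ x, Complex.exp ((inner ℝ x t : ℝ) * Complex.I) ∂(volume.withDensity
      fun x : EuclideanSpace ℝ (Fin n) => ENNReal.ofReal (Z⁻¹ * Real.exp (-‖x‖ ^ 2 / 2)))
      = ∫ x, (Z⁻¹ * Real.exp (-‖x‖ ^ 2 / 2)) • Complex.exp ((inner ℝ x t : ℝ) * Complex.I) := by
    rw [integral_withDensity_eq_integral_toReal_smul (by fun_prop) (Eventually.of_forall fun x => by simp)]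
    simp only [ENNReal.toReal_ofReal (hnn _)]
  rw [e]
  have e2 : ∀ x : EuclideanSpace ℝ (Fin n), (Z⁻¹ * Real.exp (-‖x‖ ^ 2 / 2)) • Complex.exp ((inner ℝ x t : ℝ) * Complex.I)
      = (Z⁻¹ : ℂ) * (((Real.exp (-‖x‖ ^ 2 / 2) : ℝ) : ℂ) * Complex.exp ((inner ℝ x t : ℝ) * Complex.I)) := by
    intro x; rw [Complex.real_smul]; push_cast; ring
  simp_rw [e2]
  rw [integral_const_mul, hF t, ← mul_assoc, inv_mul_cancel₀ (by exact_mod_cast hZ0.ne'), one_mul]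

lemma integral_stdGaussian (f : EuclideanSpace ℝ (Fin n) → ℝ) :
    ∫ x, f x ∂(stdGaussian (EuclideanSpace ℝ (Fin n)))
      = (∫ x : EuclideanSpace ℝ (Fin n), Real.exp (-‖x‖ ^ 2 / 2))⁻¹ * ∫ x, Real.exp (-‖x‖ ^ 2 / 2) * f x := by
  have hZ0 := integral_exp_neg_norm_sq_pos n
  rw [stdGaussian_eq_withDensity, integral_withDensity_eq_integral_toReal_smul (by fun_prop)
    (Eventually.of_forall fun x => by simp), ← integral_const_mul]
  refine integral_congr_ae (Eventually.of_forall fun x => ?_)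
  simp only [smul_eq_mul]
  rw [ENNReal.toReal_ofReal (by positivity)]
  ring

lemma integrable_exp_mul_of_stdGaussian {f : EuclideanSpace ℝ (Fin n) → ℝ}
    (hf : Integrable f (stdGaussian (EuclideanSpace ℝ (Fin n)))) :
    Integrable fun x => Real.exp (-‖x‖ ^ 2 / 2) * f x := by
  have hZ0 := integral_exp_neg_norm_sq_pos n
  rw [stdGaussian_eq_withDensity, integrable_withDensity_iff_integrable_smul' (by fun_prop)
    (Eventually.of_forall fun x => by simp)] at hf
  refine (hf.const_mul (∫ x : EuclideanSpace ℝ (Fin n), Real.exp (-‖x‖ ^ 2 / 2))).congr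
    (Eventually.of_forall fun x => ?_)
  simp only [smul_eq_mul]
  rw [ENNReal.toReal_ofReal (by positivity), ← mul_assoc, ← mul_assoc, mul_inv_cancel₀ hZ0.ne', one_mul]

/-- The half-line Gaussian moments. -/
noncomputable def gaussianMoment (k : ℕ) : ℝ := ∫ s in Ioi (0 : ℝ), s ^ k * Real.exp (-s ^ 2 / 2)

lemma gaussianMoment_eq (k : ℕ) :
    gaussianMoment k = (1 / 2 : ℝ) ^ (-((k : ℝ) + 1) / 2) * (1 / 2) * Real.Gamma (((k : ℝ) + 1) / 2) := by
  rw [gaussianMoment, ← integral_rpow_mul_exp_neg_mul_rpow (p := 2) (q := k) (b := 1 / 2) (by norm_num)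
    (by have : (0 : ℝ) ≤ k := Nat.cast_nonneg k
        linarith) (by norm_num)]
  refine setIntegral_congr_fun measurableSet_Ioi fun s hs => ?_
  simp only [Real.rpow_natCast, Real.rpow_two]
  congr 2; ring

lemma gaussianMoment_pos (k : ℕ) : 0 < gaussianMoment k := by
  rw [gaussianMoment_eq]
  have : 0 < Real.Gamma (((k : ℝ) + 1) / 2) := Real.Gamma_pos_of_pos (by positivity)
  positivity

/-- The functional equation of Γ. At k = n - 1 the ratio is n, the source of the constant in
`sphere_poincare`. -/
lemma gaussianMoment_add_two (k : ℕ) : gaussianMoment (k + 2) = (k + 1) * gaussianMoment k := by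
  rw [gaussianMoment_eq, gaussianMoment_eq]
  have h1 : (((k + 2 : ℕ) : ℝ) + 1) / 2 = ((k : ℝ) + 1) / 2 + 1 := by push_cast; ring
  have h2 : -(((k + 2 : ℕ) : ℝ) + 1) / 2 = -((k : ℝ) + 1) / 2 - 1 := by push_cast; ring
  rw [h1, h2, Real.Gamma_add_one (by positivity), Real.rpow_sub_one (by norm_num)]
  ring

/-- **The sharp Poincaré inequality on the sphere**: the first nonzero eigenvalue of the
Laplacian is `n - 1`. -/
theorem sphere_poincare [NeZero n] {v : UnitSphere n → ℝ} {K : NNReal} (hv : LipschitzWith K v)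
    (hmean : ∫ x, v x ∂(surfaceMeasure n) = 0) :
    ((n : ℝ) - 1) * ∫ x, v x ^ 2 ∂(surfaceMeasure n)
      ≤ ∫ x, ‖tangentialGradient v x‖ ^ 2 ∂(surfaceMeasure n) := by
  obtain ⟨K', hF⟩ := exists_lipschitzWith_oneHom hv
  set F := oneHom v
  set G : EuclideanSpace ℝ (Fin n) → ℝ := fun x => ∑ i, (lineDeriv ℝ F x (EuclideanSpace.single i 1)) ^ 2
  have hP := stdGaussian_poincare hF
  have hFL : MemLp F 2 (stdGaussian (EuclideanSpace ℝ (Fin n))) :=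
    hF.memLp_two IsGaussian.memLp_two_id
  have hGi : Integrable G (stdGaussian (EuclideanSpace ℝ (Fin n))) := by
    refine integrable_finsetSum _ fun i _ => ?_
    refine Integrable.of_bound ((measurable_lineDeriv hF.continuous).pow_const 2).aestronglyMeasurable
      ((K' : ℝ) ^ 2) (Eventually.of_forall fun x => ?_)
    rw [norm_pow]
    refine pow_le_pow_left₀ (norm_nonneg _) ?_ 2
    refine (norm_lineDeriv_le_of_lipschitz ℝ hF).trans ?_
    simp
  rw [integral_stdGaussian, integral_stdGaussian, integral_stdGaussian,
    integral_polar _ (integrable_exp_mul_of_stdGaussian (hFL.integrable one_le_two)),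
    integral_polar _ (integrable_exp_mul_of_stdGaussian hFL.integrable_sq),
    integral_polar _ (integrable_exp_mul_of_stdGaussian hGi)] at hP
  have hn1 : n - 1 + 1 = n := Nat.succ_pred_eq_of_pos (Nat.pos_of_ne_zero (NeZero.ne n))
  have hnorm : ∀ (s : ℝ) (x : UnitSphere n), ‖s • (x : EuclideanSpace ℝ (Fin n))‖ ^ 2 = s ^ 2 := by
    intro s x; simp [norm_smul]
  -- The function F, its square and its squared gradient have degrees 1, 2 and 0, so the radial
  -- integrals are Gaussian moments of orders n, n + 1 and n - 1.
  have e1 : ∀ x : UnitSphere n, ∫ s in Ioi (0 : ℝ), s ^ (n - 1) *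
      (Real.exp (-‖s • (x : EuclideanSpace ℝ (Fin n))‖ ^ 2 / 2) * F (s • (x : EuclideanSpace ℝ (Fin n))))
      = gaussianMoment (n - 1 + 1) * v x := by
    intro x
    rw [gaussianMoment, ← integral_mul_const]
    refine setIntegral_congr_fun measurableSet_Ioi fun s hs => ?_
    simp only [F, oneHom_smul v (le_of_lt hs), hnorm]
    ring
  have e2 : ∀ x : UnitSphere n, ∫ s in Ioi (0 : ℝ), s ^ (n - 1) *
      (Real.exp (-‖s • (x : EuclideanSpace ℝ (Fin n))‖ ^ 2 / 2) * F (s • (x : EuclideanSpace ℝ (Fin n))) ^ 2)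
      = gaussianMoment (n - 1 + 2) * v x ^ 2 := by
    intro x
    rw [gaussianMoment, ← integral_mul_const]
    refine setIntegral_congr_fun measurableSet_Ioi fun s hs => ?_
    simp only [F, oneHom_smul v (le_of_lt hs), hnorm]
    ring
  have e3 : ∀ᵐ x : UnitSphere n ∂(surfaceMeasure n), ∫ s in Ioi (0 : ℝ), s ^ (n - 1) *
      (Real.exp (-‖s • (x : EuclideanSpace ℝ (Fin n))‖ ^ 2 / 2) * G (s • (x : EuclideanSpace ℝ (Fin n))))
      = gaussianMoment (n - 1) * (v x ^ 2 + ‖tangentialGradient v x‖ ^ 2) := by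
    filter_upwards [ae_differentiableAt_homogeneousExtension hv] with x hx
    rw [gaussianMoment, ← integral_mul_const]
    refine setIntegral_congr_fun measurableSet_Ioi fun s hs => ?_
    have hg := hasGradientAt_oneHom hx (show 0 < s from hs)
    have hG : G (s • (x : EuclideanSpace ℝ (Fin n))) = v x ^ 2 + ‖tangentialGradient v x‖ ^ 2 := by
      rw [← norm_sq_add_tangentialGradient, EuclideanSpace.real_norm_sq_eq]
      refine Finset.sum_congr rfl fun i _ => ?_
      rw [(hg.hasFDerivAt.hasLineDerivAt _).lineDeriv, InnerProductSpace.toDual_apply_apply,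
        EuclideanSpace.inner_single_right]
      simp
    simp only [hG, hnorm]
    ring
  rw [integral_congr_ae e3] at hP
  simp_rw [e1, e2] at hP
  rw [integral_const_mul, integral_const_mul, integral_const_mul, hmean, gaussianMoment_add_two] at hP
  obtain ⟨C, hC⟩ := exists_bound_of_lipschitz hv
  obtain ⟨C', -, hC'⟩ := exists_bound_tangentialGradient hv
  have i1 : Integrable (fun x => v x ^ 2) (surfaceMeasure n) := by
    refine Integrable.of_bound (hv.continuous.measurable.pow_const 2).aestronglyMeasurable ((C : ℝ) ^ 2)
      (Eventually.of_forall fun x => ?_)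
    rw [norm_pow]
    exact pow_le_pow_left₀ (norm_nonneg _) (hC x) 2
  have i2 : Integrable (fun x => ‖tangentialGradient v x‖ ^ 2) (surfaceMeasure n) := by
    refine Integrable.of_bound ((measurable_tangentialGradient v).norm.pow_const 2).aestronglyMeasurable
      (C' ^ 2) ?_
    filter_upwards [hC'] with x hx
    rw [norm_pow, norm_norm]
    exact pow_le_pow_left₀ (norm_nonneg _) hx 2
  rw [integral_add i1 i2] at hP
  have hn2 : ((n - 1 : ℕ) : ℝ) + 1 = n := by exact_mod_cast hn1
  rw [hn2] at hP
  have hZ0 := integral_exp_neg_norm_sq_pos n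
  set Z := ∫ x : EuclideanSpace ℝ (Fin n), Real.exp (-‖x‖ ^ 2 / 2)
  have hm := gaussianMoment_pos (n - 1)
  set m := gaussianMoment (n - 1)
  set A := ∫ x, v x ^ 2 ∂(surfaceMeasure n)
  set B := ∫ x, ‖tangentialGradient v x‖ ^ 2 ∂(surfaceMeasure n)
  -- With the moment recursion the Gaussian inequality reads n m A ≤ m (A + B), up to the
  -- normalization Z.
  have hfin : 0 ≤ (Z⁻¹ * m) * (B - (n - 1) * A) := by
    simp only [mul_zero, ne_eq, OfNat.ofNat_ne_zero, not_false_eq_true, zero_pow, sub_zero] at hP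
    linarith
  have := nonneg_of_mul_nonneg_right hfin (by positivity)
  linarith

end SpherePoincare

/-! ### The divergence theorem on star-shaped Lipschitz domains -/

section Divergence

open Set Measure Filter Topology

variable {n : ℕ}

lemma hasFDerivAt_apply_of_differentiableAt {F : EuclideanSpace ℝ (Fin n) → EuclideanSpace ℝ (Fin n)}
    {y : EuclideanSpace ℝ (Fin n)} (h : DifferentiableAt ℝ F y) (i : Fin n) :
    HasFDerivAt (fun y => F y i) ((EuclideanSpace.proj i : EuclideanSpace ℝ (Fin n) →L[ℝ] ℝ).comp
      (fderiv ℝ F y)) y :=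
  (EuclideanSpace.proj (𝕜 := ℝ) i).hasFDerivAt.comp y h.hasFDerivAt

lemma lipschitzWith_apply {F : EuclideanSpace ℝ (Fin n) → EuclideanSpace ℝ (Fin n)} {L : NNReal}
    (hF : LipschitzWith L F) (i : Fin n) : LipschitzWith L fun y => F y i := by
  refine LipschitzWith.of_dist_le_mul fun y z => ?_
  refine le_trans ?_ (hF.dist_le_mul y z)
  rw [dist_eq_norm, dist_eq_norm]
  exact PiLp.norm_apply_le (F y - F z) i

lemma measurable_divergence (F : EuclideanSpace ℝ (Fin n) → EuclideanSpace ℝ (Fin n)) :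
    Measurable (divergence F) := by
  unfold divergence
  refine Finset.measurable_sum _ fun i _ => ?_
  exact (EuclideanSpace.proj (𝕜 := ℝ) i).continuous.measurable.comp
    (measurable_fderiv_apply_const ℝ F (EuclideanSpace.single i 1))

lemma abs_divergence_le {F : EuclideanSpace ℝ (Fin n) → EuclideanSpace ℝ (Fin n)} {L : NNReal}
    (hF : LipschitzWith L F) (y : EuclideanSpace ℝ (Fin n)) : |divergence F y| ≤ n * L := by
  unfold divergence
  refine (Finset.abs_sum_le_sum_abs _ _).trans ?_
  have : ∀ i ∈ (Finset.univ : Finset (Fin n)), |(fderiv ℝ F y (EuclideanSpace.single i 1)) i| ≤ L := by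
    intro i _
    refine (PiLp.norm_apply_le (fderiv ℝ F y (EuclideanSpace.single i 1)) i).trans ?_
    refine (ContinuousLinearMap.le_opNorm _ _).trans ?_
    simpa using norm_fderiv_le_of_lipschitz ℝ hF
  refine (Finset.sum_le_sum this).trans ?_
  simp

lemma integrable_divergence {F : EuclideanSpace ℝ (Fin n) → EuclideanSpace ℝ (Fin n)} {L : NNReal}
    (hF : LipschitzWith L F) (hc : HasCompactSupport F) : Integrable (divergence F) := by
  have hsupp : Function.support (divergence F) ⊆ tsupport F := by
    intro y hy
    by_contra hcon
    apply hy
    have : fderiv ℝ F y = 0 := by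
      have := (tsupport_fderiv_subset ℝ (f := F)).trans (le_refl _)
      by_contra h0
      exact hcon (support_fderiv_subset ℝ h0)
    simp [divergence, this]
  rw [← integrableOn_iff_integrable_of_support_subset hsupp]
  refine IntegrableOn.of_bound hc.measure_lt_top
    (measurable_divergence F).aestronglyMeasurable (n * L : ℝ) (Eventually.of_forall fun y => ?_)
  exact abs_divergence_le hF y

/-- Integration by parts for a Lipschitz function and a compactly supported Lipschitz field. -/
lemma integral_mul_divergence {F : EuclideanSpace ℝ (Fin n) → EuclideanSpace ℝ (Fin n)} {L : NNReal}
    (hF : LipschitzWith L F) (hc : HasCompactSupport F) {η : EuclideanSpace ℝ (Fin n) → ℝ} {K : NNReal}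
    (hη : LipschitzWith K η) :
    ∫ y, η y * divergence F y = -∫ y, inner ℝ (gradient η y) (F y) := by
  have hFi := lipschitzWith_apply hF
  have hci : ∀ i, HasCompactSupport fun y => F y i := fun i =>
    hc.comp_left (g := fun z : EuclideanSpace ℝ (Fin n) => z i) rfl
  have hae1 : ∀ᵐ y, η y * divergence F y
      = -∑ i, lineDeriv ℝ (fun y => F y i) y (-EuclideanSpace.single i 1) * η y := by
    filter_upwards [hF.ae_differentiableAt] with y hy
    rw [divergence, Finset.mul_sum, ← Finset.sum_neg_distrib]
    refine Finset.sum_congr rfl fun i _ => ?_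
    rw [((hasFDerivAt_apply_of_differentiableAt hy i).hasLineDerivAt _).lineDeriv]
    simp [mul_comm]
  have hae2 : ∀ᵐ y, inner ℝ (gradient η y) (F y)
      = ∑ i, lineDeriv ℝ η y (EuclideanSpace.single i 1) * F y i := by
    filter_upwards [hη.ae_differentiableAt] with y hy
    rw [PiLp.inner_apply]
    refine Finset.sum_congr rfl fun i _ => ?_
    rw [(hy.hasGradientAt.hasFDerivAt.hasLineDerivAt _).lineDeriv, InnerProductSpace.toDual_apply_apply,
      EuclideanSpace.inner_single_right]
    simp [mul_comm]
  rw [integral_congr_ae hae1, integral_congr_ae hae2, integral_neg, integral_finsetSum, integral_finsetSum]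
  · congr 1
    refine Finset.sum_congr rfl fun i _ => ?_
    exact (hη.integral_lineDeriv_mul_eq (hFi i) (hci i) _).symm
  · intro i _
    have hi : Integrable fun y => F y i := (hFi i).continuous.integrable_of_hasCompactSupport (hci i)
    refine hi.bdd_mul (c := K) (measurable_lineDeriv hη.continuous).aestronglyMeasurable
      (Eventually.of_forall fun y => ?_)
    simpa using norm_lineDeriv_le_of_lipschitz (x₀ := y) (v := EuclideanSpace.single i (1 : ℝ)) ℝ hη
  · intro i _
    have hs : HasCompactSupport fun y => lineDeriv ℝ (fun y => F y i) y (-EuclideanSpace.single i 1) := by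
      refine HasCompactSupport.intro (hci i) fun y hy => ?_
      have : (fun y => F y i) =ᶠ[𝓝 y] fun _ => 0 := notMem_tsupport_iff_eventuallyEq.mp hy
      rw [this.lineDeriv_eq]
      simp [lineDeriv]
    have hi : Integrable fun y => lineDeriv ℝ (fun y => F y i) y (-EuclideanSpace.single i 1) * η y := by
      have hsub : Function.support (fun y => lineDeriv ℝ (fun y => F y i) y (-EuclideanSpace.single i 1) * η y)
          ⊆ tsupport fun y => lineDeriv ℝ (fun y => F y i) y (-EuclideanSpace.single i 1) := by
        intro y hy
        exact subset_tsupport _ (left_ne_zero_of_mul hy)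
      rw [← integrableOn_iff_integrable_of_support_subset hsub]
      have hη' : IntegrableOn η (tsupport fun y => lineDeriv ℝ (fun y => F y i) y (-EuclideanSpace.single i 1)) :=
        hη.continuous.continuousOn.integrableOn_compact hs
      refine hη'.bdd_mul (c := L) (measurable_lineDeriv (hFi i).continuous).aestronglyMeasurable
        (Eventually.of_forall fun y => ?_)
      simpa using norm_lineDeriv_le_of_lipschitz (x₀ := y) (v := -EuclideanSpace.single i (1 : ℝ)) ℝ (hFi i)
    exact hi

/-- The piecewise linear function equal to `1` on `(-∞, 1]` and to `0` on `[1 + ε, ∞)`. -/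
noncomputable def linearCutoff (ε s : ℝ) : ℝ := max 0 (min 1 (1 - (s - 1) / ε))

lemma exists_lipschitzWith_linearCutoff (ε : ℝ) : ∃ K, LipschitzWith K (linearCutoff ε) := by
  have h : LipschitzWith ‖ε⁻¹‖₊ fun s : ℝ => 1 - (s - 1) / ε := by
    refine LipschitzWith.of_dist_le_mul fun s t => ?_
    rw [Real.dist_eq, Real.dist_eq, coe_nnnorm, Real.norm_eq_abs, ← abs_mul, ← abs_neg]
    apply le_of_eq; congr 1; ring
  exact ⟨_, (h.const_min 1).const_max 0⟩

lemma linearCutoff_of_le {ε s : ℝ} (hε : 0 < ε) (hs : s ≤ 1) : linearCutoff ε s = 1 := by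
  have : (s - 1) / ε ≤ 0 := div_nonpos_of_nonpos_of_nonneg (by linarith) hε.le
  rw [linearCutoff, min_eq_left (by linarith), max_eq_right zero_le_one]

lemma linearCutoff_of_ge {ε s : ℝ} (hε : 0 < ε) (hs : 1 + ε ≤ s) : linearCutoff ε s = 0 := by
  have : 1 ≤ (s - 1) / ε := by rw [le_div_iff₀ hε]; linarith
  rw [linearCutoff, min_eq_right (by linarith), max_eq_left (by linarith)]

lemma linearCutoff_of_mem {ε s : ℝ} (hε : 0 < ε) (h1 : 1 ≤ s) (h2 : s ≤ 1 + ε) :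
    linearCutoff ε s = 1 - (s - 1) / ε := by
  have h3 : (s - 1) / ε ≤ 1 := by rw [div_le_iff₀ hε]; linarith
  have h4 : 0 ≤ (s - 1) / ε := div_nonneg (by linarith) hε.le
  rw [linearCutoff, min_eq_right (by linarith), max_eq_right (by linarith)]

lemma abs_linearCutoff_le (ε s : ℝ) : |linearCutoff ε s| ≤ 1 := by
  rw [linearCutoff, abs_of_nonneg (le_max_left _ _)]
  exact max_le zero_le_one (min_le_left _ _)

lemma gradient_eq_of_eventuallyEq {f g : EuclideanSpace ℝ (Fin n) → ℝ} {y : EuclideanSpace ℝ (Fin n)}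
    (h : f =ᶠ[𝓝 y] g) : gradient f y = gradient g y := by
  rw [gradient, gradient, h.fderiv_eq]

/-- The two corners of the cutoff are excluded; in the application each ray meets either level only
once, so they are negligible. -/
lemma gradient_linearCutoff_comp {G : EuclideanSpace ℝ (Fin n) → ℝ} (hG : Continuous G)
    {y N : EuclideanSpace ℝ (Fin n)} (hN : HasGradientAt G N y) {ε : ℝ} (hε : 0 < ε)
    (h1 : G y ≠ 1) (h2 : G y ≠ 1 + ε) :
    gradient (fun y => linearCutoff ε (G y)) y
      = if 1 < G y ∧ G y ≤ 1 + ε then (-ε⁻¹) • N else 0 := by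
  rcases lt_or_gt_of_ne h1 with h | h
  · rw [if_neg (fun hh => absurd hh.1 (not_lt.mpr h.le))]
    rw [gradient_eq_of_eventuallyEq (g := fun _ => 1), gradient_fun_const]
    filter_upwards [hG.continuousAt.eventually_lt_const h] with z hz
    exact linearCutoff_of_le hε hz.le
  rcases lt_or_gt_of_ne h2 with h' | h'
  · rw [if_pos ⟨h, h'.le⟩]
    rw [gradient_eq_of_eventuallyEq (g := fun z => 1 - (G z - 1) / ε)]
    · refine HasGradientAt.gradient ?_
      rw [hasGradientAt_iff_hasFDerivAt]
      have := (((hN.hasFDerivAt.sub_const 1).mul_const ε⁻¹).const_sub 1)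
      simp only [← div_eq_mul_inv] at this
      convert! this using 1
      ext z; simp
    · filter_upwards [hG.continuousAt.eventually_lt_const h', hG.continuousAt.eventually_const_lt h] with z hz hz'
      exact linearCutoff_of_mem hε hz'.le hz.le
  · rw [if_neg (fun hh => absurd hh.2 (not_le.mpr h'))]
    rw [gradient_eq_of_eventuallyEq (g := fun _ => 0), gradient_fun_const]
    filter_upwards [hG.continuousAt.eventually_const_lt h'] with z hz
    exact linearCutoff_of_ge hε hz.le

/-- The divergence theorem on `{oneHom ψ ≤ 1} = {s x : x ∈ S, 0 ≤ s ≤ 1 / ψ x}`. -/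
theorem integral_divergence_eq [NeZero n] {ψ : UnitSphere n → ℝ} {K : NNReal} (hψ : LipschitzWith K ψ)
    (hpos : ∀ x, 0 < ψ x) {F : EuclideanSpace ℝ (Fin n) → EuclideanSpace ℝ (Fin n)} {L : NNReal}
    (hF : LipschitzWith L F) (hc : HasCompactSupport F) :
    ∫ y in {y | oneHom ψ y ≤ 1}, divergence F y
      = ∫ x : UnitSphere n, (ψ x)⁻¹ ^ n * inner ℝ (ψ x • (x : EuclideanSpace ℝ (Fin n))
          + tangentialGradient ψ x) (F ((ψ x)⁻¹ • (x : EuclideanSpace ℝ (Fin n)))) ∂(surfaceMeasure n) := by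
  obtain ⟨KG, hG⟩ := exists_lipschitzWith_oneHom hψ
  set G := oneHom ψ
  have hRm : MeasurableSet {y | G y ≤ 1} := measurableSet_le hG.continuous.measurable measurable_const
  have hdi := integrable_divergence hF hc
  -- As ε decreases to 0 the cutoffs converge pointwise to the indicator of the closed sublevel set,
  -- boundary included.
  have hlim1 : Tendsto (fun ε : ℝ => ∫ y, linearCutoff ε (G y) * divergence F y) (𝓝[>] 0)
      (𝓝 (∫ y in {y | G y ≤ 1}, divergence F y)) := by
    rw [← integral_indicator hRm]
    refine tendsto_integral_filter_of_dominated_convergence (fun y => |divergence F y|) ?_ ?_ hdi.abs ?_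
    · refine Eventually.of_forall fun ε => ?_
      obtain ⟨K1, h1⟩ := exists_lipschitzWith_linearCutoff ε
      exact ((h1.continuous.comp hG.continuous).measurable.mul (measurable_divergence F)).aestronglyMeasurable
    · refine Eventually.of_forall fun ε => Eventually.of_forall fun y => ?_
      rw [norm_mul, Real.norm_eq_abs, Real.norm_eq_abs]
      exact mul_le_of_le_one_left (abs_nonneg _) (abs_linearCutoff_le _ _)
    · refine Eventually.of_forall fun y => ?_
      by_cases hy : G y ≤ 1
      · refine Tendsto.congr' (f₁ := fun _ => divergence F y) ?_ ?_
        · filter_upwards [self_mem_nhdsWithin] with ε hε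
          rw [linearCutoff_of_le hε hy, one_mul]
        · rw [indicator_of_mem (by exact hy)]; exact tendsto_const_nhds
      · refine Tendsto.congr' (f₁ := fun _ => 0) ?_ ?_
        · filter_upwards [Ioo_mem_nhdsGT (show (0 : ℝ) < G y - 1 by linarith)] with ε hε
          rw [linearCutoff_of_ge hε.1 (by linarith [hε.2]), zero_mul]
        · rw [indicator_of_notMem (by exact hy)]; exact tendsto_const_nhds
  obtain ⟨CF, hCF⟩ := hF.continuous.bounded_above_of_compact_support hc
  have hCF0 : 0 ≤ CF := (norm_nonneg _).trans (hCF 0)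
  set N : UnitSphere n → EuclideanSpace ℝ (Fin n) := fun x =>
    ψ x • (x : EuclideanSpace ℝ (Fin n)) + tangentialGradient ψ x
  set β : UnitSphere n → ℝ → ℝ := fun x s =>
    s ^ (n - 1) * inner ℝ (N x) (F (s • (x : EuclideanSpace ℝ (Fin n))))
  have hβc : ∀ x, Continuous (β x) := fun x =>
    (continuous_pow _).mul (continuous_const.inner (hF.continuous.comp (by fun_prop)))
  set I : ℝ → UnitSphere n → ℝ := fun ε x => ∫ s in Ioi (0 : ℝ), s ^ (n - 1) *
    inner ℝ (gradient (fun y => linearCutoff ε (G y)) (s • (x : EuclideanSpace ℝ (Fin n))))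
      (F (s • (x : EuclideanSpace ℝ (Fin n))))
  have hIm : ∀ ε, AEStronglyMeasurable (I ε) (surfaceMeasure n) := by
    intro ε
    refine (StronglyMeasurable.integral_prod_right (f := fun (x : UnitSphere n) (s : ℝ) => s ^ (n - 1) *
      inner ℝ (gradient (fun y => linearCutoff ε (G y)) (s • (x : EuclideanSpace ℝ (Fin n))))
      (F (s • (x : EuclideanSpace ℝ (Fin n))))) ?_).aestronglyMeasurable
    refine Measurable.stronglyMeasurable ?_
    refine Measurable.mul (by fun_prop) (Measurable.inner ?_ ?_)
    · exact (measurable_gradient_euclidean _).comp (by fun_prop)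
    · exact hF.continuous.measurable.comp (by fun_prop)
  -- On the ray through x the gradient of the cutoff is -ε⁻¹ N x for radii between ρ = 1/ψ x and (1
  -- + ε)ρ and 0 outside, so the radial integral is a difference quotient.
  have hIeq : ∀ ε > 0, ∀ x : UnitSphere n,
      DifferentiableAt ℝ (homogeneousExtension ψ) (x : EuclideanSpace ℝ (Fin n)) →
      I ε x = -(ε⁻¹ * ∫ s in ((ψ x)⁻¹)..((ψ x)⁻¹ + ε * (ψ x)⁻¹), β x s) := by
    intro ε hε x hx
    have hρ : 0 < (ψ x)⁻¹ := inv_pos.mpr (hpos x)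
    rw [intervalIntegral.integral_of_le (by nlinarith [mul_pos hε hρ]), ← integral_const_mul, ← integral_neg]
    have hsub : Ioc (ψ x)⁻¹ ((ψ x)⁻¹ + ε * (ψ x)⁻¹) = Ioi 0 ∩ Ioc (ψ x)⁻¹ ((ψ x)⁻¹ + ε * (ψ x)⁻¹) := by
      rw [inter_eq_right.mpr]
      intro s hs
      exact lt_trans hρ hs.1
    rw [hsub, ← setIntegral_indicator measurableSet_Ioc]
    refine setIntegral_congr_ae measurableSet_Ioi ?_
    have h1 := (countable_singleton ((ψ x)⁻¹)).ae_notMem (volume : Measure ℝ)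
    have h2 := (countable_singleton ((ψ x)⁻¹ + ε * (ψ x)⁻¹)).ae_notMem (volume : Measure ℝ)
    filter_upwards [h1, h2] with s hs1 hs2 hs0
    have hs0' : (0 : ℝ) < s := hs0
    have hGs : G (s • (x : EuclideanSpace ℝ (Fin n))) = s * ψ x := oneHom_smul ψ hs0'.le x
    have hψ0 := hpos x
    have e1 : (ψ x)⁻¹ < s ↔ 1 < s * ψ x := by rw [inv_lt_iff_one_lt_mul₀ hψ0]
    have e2 : s ≤ (ψ x)⁻¹ + ε * (ψ x)⁻¹ ↔ s * ψ x ≤ 1 + ε := by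
      rw [show (ψ x)⁻¹ + ε * (ψ x)⁻¹ = (1 + ε) / ψ x by field_simp, le_div_iff₀ hψ0]
    have hne1 : s * ψ x ≠ 1 := fun h => hs1 (by simp only [mem_singleton_iff]; field_simp; exact h)
    have hne2 : s * ψ x ≠ 1 + ε := fun h => hs2 (by simp only [mem_singleton_iff]; field_simp; exact h)
    rw [gradient_linearCutoff_comp hG.continuous (hasGradientAt_oneHom hx hs0') hε (by rwa [hGs])
      (by rwa [hGs]), hGs]
    by_cases hmem : s ∈ Ioc (ψ x)⁻¹ ((ψ x)⁻¹ + ε * (ψ x)⁻¹)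
    · rw [indicator_of_mem hmem, if_pos ⟨e1.mp hmem.1, e2.mp hmem.2⟩, inner_smul_left]
      simp only [β, N, conj_trivial]
      ring
    · rw [indicator_of_notMem hmem, if_neg, inner_zero_left, mul_zero]
      exact fun h => hmem ⟨e1.mpr h.1, e2.mpr h.2⟩
  obtain ⟨Cψ, hCψ⟩ := exists_bound_of_lipschitz hψ
  obtain ⟨Cg, hCg0, hCg⟩ := exists_bound_tangentialGradient hψ
  obtain ⟨c, hc0, hcψ⟩ : ∃ c : ℝ, 0 < c ∧ ∀ x, (ψ x)⁻¹ ≤ c := by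
    have hcont : Continuous fun x => (ψ x)⁻¹ := hψ.continuous.inv₀ fun x => (hpos x).ne'
    obtain ⟨C, hC⟩ := isCompact_univ.exists_bound_of_continuousOn hcont.continuousOn
    refine ⟨max C 1, lt_max_of_lt_right one_pos, fun x => ?_⟩
    exact (le_abs_self _).trans ((hC x (mem_univ x)).trans (le_max_left _ _))
  have hlim2 : Tendsto (fun ε : ℝ => ∫ x, I ε x ∂(surfaceMeasure n)) (𝓝[>] 0)
      (𝓝 (∫ x, -((ψ x)⁻¹ * β x (ψ x)⁻¹) ∂(surfaceMeasure n))) := by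
    -- For ε ≤ 1 the layer lies in s ≤ 2c and has length at most ε c, while |N| ≤ Cψ + Cg; the
    -- length absorbs the factor ε⁻¹.
    refine tendsto_integral_filter_of_dominated_convergence
      (fun _ => ((2 * c) ^ (n - 1) * ((Cψ + Cg) * CF)) * c) (Eventually.of_forall hIm) ?_
      (integrable_const _) ?_
    · filter_upwards [Ioc_mem_nhdsGT (zero_lt_one' ℝ)] with ε hε
      filter_upwards [ae_differentiableAt_homogeneousExtension hψ, hCg] with x hx hgx
      rw [hIeq ε hε.1 x hx, norm_neg, norm_mul, norm_inv, Real.norm_of_nonneg hε.1.le]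
      have hρ : 0 < (ψ x)⁻¹ := inv_pos.mpr (hpos x)
      have hb : ‖∫ s in ((ψ x)⁻¹)..((ψ x)⁻¹ + ε * (ψ x)⁻¹), β x s‖
          ≤ ((2 * c) ^ (n - 1) * ((Cψ + Cg) * CF)) * |(ψ x)⁻¹ + ε * (ψ x)⁻¹ - (ψ x)⁻¹| := by
        refine intervalIntegral.norm_integral_le_of_norm_le_const fun s hs => ?_
        rw [uIoc_of_le (by nlinarith [mul_pos hε.1 hρ])] at hs
        have hs0 : 0 < s := hρ.trans hs.1
        have hs2 : s ≤ 2 * c := by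
          have := hcψ x
          have h3 : ε * (ψ x)⁻¹ ≤ (ψ x)⁻¹ := mul_le_of_le_one_left hρ.le hε.2
          linarith [hs.2]
        simp only [β]
        rw [norm_mul, norm_pow, Real.norm_of_nonneg hs0.le]
        refine mul_le_mul (pow_le_pow_left₀ hs0.le hs2 _) ?_ (norm_nonneg _) (by positivity)
        refine (norm_inner_le_norm _ _).trans ?_
        refine mul_le_mul ?_ (hCF _) (norm_nonneg _) (by positivity)
        refine (norm_add_le _ _).trans (add_le_add ?_ hgx)
        rw [norm_smul]
        simpa using hCψ x
      rw [add_sub_cancel_left, abs_of_pos (mul_pos hε.1 hρ)] at hb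
      have hM : 0 ≤ (2 * c) ^ (n - 1) * ((Cψ + Cg) * CF) := by positivity
      calc ε⁻¹ * ‖∫ s in ((ψ x)⁻¹)..((ψ x)⁻¹ + ε * (ψ x)⁻¹), β x s‖
          ≤ ε⁻¹ * (((2 * c) ^ (n - 1) * ((Cψ + Cg) * CF)) * (ε * (ψ x)⁻¹)) :=
            mul_le_mul_of_nonneg_left hb (inv_nonneg.mpr hε.1.le)
        _ = ((2 * c) ^ (n - 1) * ((Cψ + Cg) * CF)) * (ψ x)⁻¹ := by
            have := hε.1.ne'
            field_simp
        _ ≤ _ := mul_le_mul_of_nonneg_left (hcψ x) hM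
    · filter_upwards [ae_differentiableAt_homogeneousExtension hψ] with x hx
      set ρ := (ψ x)⁻¹
      -- The layer has width proportional to ρ; this extra factor ρ turns the exponent n - 1 into n.
      have hd : HasDerivAt (fun t : ℝ => ∫ s in ρ..(ρ + t * ρ), β x s) (β x ρ * ρ) 0 := by
        have h1 : HasDerivAt (fun t : ℝ => ρ + t * ρ) ρ 0 := by
          simpa using ((hasDerivAt_id (0 : ℝ)).mul_const ρ).const_add ρ
        have h2 : HasDerivAt (fun u : ℝ => ∫ s in ρ..u, β x s) (β x (ρ + 0 * ρ)) (ρ + 0 * ρ) :=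
          intervalIntegral.integral_hasDerivAt_right ((hβc x).intervalIntegrable _ _)
            ((hβc x).stronglyMeasurableAtFilter _ _) (hβc x).continuousAt
        have h3 := h2.comp 0 h1
        rw [zero_mul, add_zero] at h3
        exact h3
      have ht := hd.tendsto_slope_zero_right.neg
      simp only [zero_add, zero_mul, add_zero, intervalIntegral.integral_same, sub_zero, smul_eq_mul] at ht
      rw [mul_comm ρ]
      refine ht.congr' ?_
      filter_upwards [self_mem_nhdsWithin] with ε hε
      rw [hIeq ε hε x hx]
  have heq : ∀ᶠ ε : ℝ in 𝓝[>] 0, -∫ x, I ε x ∂(surfaceMeasure n)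
      = ∫ y, linearCutoff ε (G y) * divergence F y := by
    refine Eventually.of_forall fun ε => ?_
    obtain ⟨K1, h1⟩ := exists_lipschitzWith_linearCutoff ε
    have h2 := h1.comp hG
    rw [show (fun y => linearCutoff ε (G y) * divergence F y)
      = fun y => (linearCutoff ε ∘ G) y * divergence F y from rfl, integral_mul_divergence hF hc h2,
      integral_polar]
    · rfl
    · have hFi : Integrable fun y => ‖F y‖ :=
        hF.continuous.norm.integrable_of_hasCompactSupport hc.norm
      refine (hFi.const_mul ((K1 * KG : NNReal) : ℝ)).mono'
        (Measurable.inner (measurable_gradient_euclidean _) hF.continuous.measurable).aestronglyMeasurable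
        (Eventually.of_forall fun y => ?_)
      refine (norm_inner_le_norm _ _).trans ?_
      exact mul_le_mul_of_nonneg_right (norm_gradient_le_of_lipschitz h2 y) (norm_nonneg _)
  have hfin := tendsto_nhds_unique (hlim2.neg.congr' heq) hlim1
  rw [← hfin, ← integral_neg]
  refine integral_congr_ae (Eventually.of_forall fun x => ?_)
  have hp : (ψ x)⁻¹ ^ n = (ψ x)⁻¹ * (ψ x)⁻¹ ^ (n - 1) := by
    rw [← pow_succ', Nat.sub_add_cancel (Nat.pos_of_ne_zero (NeZero.ne n))]
  simp only [β, N, neg_neg]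
  rw [hp, mul_assoc]

end Divergence

/-! ### The weighted perimeter of star-shaped Lipschitz domains -/

section Perimeter

open Set Measure Filter Topology

variable {n : ℕ}

/-- Composing w with the norm may destroy differentiability at the origin; Lipschitz regularity
survives and is all that the divergence theorem asks for. -/
lemma exists_lipschitzWith_weight_smul {w : ℝ → ℝ} (hw : ContDiff ℝ 1 w)
    {X : EuclideanSpace ℝ (Fin n) → EuclideanSpace ℝ (Fin n)} (hX : ContDiff ℝ 1 X)
    (hc : HasCompactSupport X) :
    ∃ L, LipschitzWith L fun y => Real.exp (w ‖y‖) • X y := by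
  obtain ⟨KX, hKX⟩ := hX.lipschitzWith_of_hasCompactSupport hc one_ne_zero
  obtain ⟨CX, hCX⟩ := hX.continuous.bounded_above_of_compact_support hc
  obtain ⟨R, hR0, hR⟩ := hc.isBounded.subset_closedBall_lt 0 0
  have hh : ContDiff ℝ 1 fun s => Real.exp (w s) := hw.exp
  obtain ⟨Kh, hKh⟩ := hh.contDiffOn.exists_lipschitzOnWith (s := Icc 0 R) one_ne_zero
    (convex_Icc 0 R) isCompact_Icc
  obtain ⟨Ch, hCh⟩ := isCompact_Icc.exists_bound_of_continuousOn (s := Icc 0 R) hh.continuous.continuousOn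
  -- Capping the radius at R, beyond the support of X, makes the weight bounded and globally
  -- Lipschitz without changing the product.
  set W : EuclideanSpace ℝ (Fin n) → ℝ := fun y => Real.exp (w (min ‖y‖ R))
  have hmem : ∀ y : EuclideanSpace ℝ (Fin n), min ‖y‖ R ∈ Icc 0 R := fun y =>
    ⟨le_min (norm_nonneg y) hR0.le, min_le_right _ _⟩
  have hWl : ∀ y z, ‖W y - W z‖ ≤ Kh * ‖y - z‖ := by
    intro y z
    have h1 := hKh.dist_le_mul _ (hmem y) _ (hmem z)
    have h2 : dist (min ‖y‖ R) (min ‖z‖ R) ≤ ‖y - z‖ := by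
      have := (lipschitzWith_one_norm (E := EuclideanSpace ℝ (Fin n))).min_const R
      simpa [dist_eq_norm] using this.dist_le_mul y z
    rw [dist_eq_norm] at h1
    exact h1.trans (mul_le_mul_of_nonneg_left h2 Kh.coe_nonneg)
  have hWb : ∀ y, ‖W y‖ ≤ Ch := fun y => hCh _ (hmem y)
  have hCh0 : 0 ≤ Ch := (norm_nonneg _).trans (hWb 0)
  have hCX0 : 0 ≤ CX := (norm_nonneg _).trans (hCX 0)
  have heq : (fun y => Real.exp (w ‖y‖) • X y) = fun y => W y • X y := by
    ext1 y
    by_cases hy : X y = 0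
    · simp [hy]
    · have : y ∈ Metric.closedBall 0 R := hR (subset_tsupport _ hy)
      rw [mem_closedBall_zero_iff] at this
      simp only [W, min_eq_left this]
  rw [heq]
  refine ⟨(Ch * KX + Kh * CX).toNNReal, LipschitzWith.of_dist_le_mul fun y z => ?_⟩
  rw [Real.coe_toNNReal _ (by positivity), dist_eq_norm, dist_eq_norm]
  calc ‖W y • X y - W z • X z‖ = ‖W y • (X y - X z) + (W y - W z) • X z‖ := by
        congr 1; module
    _ ≤ ‖W y‖ * ‖X y - X z‖ + ‖W y - W z‖ * ‖X z‖ := by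
        refine (norm_add_le _ _).trans ?_
        rw [norm_smul, norm_smul]
    _ ≤ Ch * (KX * ‖y - z‖) + (Kh * ‖y - z‖) * CX := by
        have h1 := hKX.dist_le_mul y z
        rw [dist_eq_norm, dist_eq_norm] at h1
        gcongr
        · exact hWb y
        · exact hWl y z
        · exact hCX z
    _ = _ := by ring

/-- The weighted outer normal of `{oneHom ψ ≤ 1}`, parametrized by the sphere and multiplied by the
surface element. -/
noncomputable def weightedNormal (w : ℝ → ℝ) (ψ : UnitSphere n → ℝ) (x : UnitSphere n) :
    EuclideanSpace ℝ (Fin n) :=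
  ((ψ x)⁻¹ ^ n * Real.exp (w (ψ x)⁻¹)) • (ψ x • (x : EuclideanSpace ℝ (Fin n)) + tangentialGradient ψ x)

lemma measurable_weightedNormal {w : ℝ → ℝ} (hw : Continuous w) {ψ : UnitSphere n → ℝ}
    (hψ : Continuous ψ) : Measurable (weightedNormal w ψ) := by
  have h1 : Measurable ψ := hψ.measurable
  have h2 : Measurable fun x => w (ψ x)⁻¹ := hw.measurable.comp h1.inv
  have h3 := measurable_tangentialGradient ψ
  unfold weightedNormal
  fun_prop

lemma exists_bound_weightedNormal [NeZero n] {w : ℝ → ℝ} (hw : Continuous w) {ψ : UnitSphere n → ℝ}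
    {K : NNReal} (hψ : LipschitzWith K ψ) (hpos : ∀ x, 0 < ψ x) :
    ∃ M : ℝ, 0 ≤ M ∧ ∀ᵐ x ∂(surfaceMeasure n), ‖weightedNormal w ψ x‖ ≤ M := by
  obtain ⟨Cψ, hCψ⟩ := exists_bound_of_lipschitz hψ
  obtain ⟨Cg, hCg0, hCg⟩ := exists_bound_tangentialGradient hψ
  have hinv : Continuous fun x => (ψ x)⁻¹ := hψ.continuous.inv₀ fun x => (hpos x).ne'
  have hcont : Continuous fun x => (ψ x)⁻¹ ^ n * Real.exp (w (ψ x)⁻¹) :=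
    (hinv.pow n).mul (hw.comp hinv).rexp
  obtain ⟨C, hC⟩ := isCompact_univ.exists_bound_of_continuousOn hcont.continuousOn
  refine ⟨|C| * (Cψ + Cg), by positivity, ?_⟩
  filter_upwards [hCg] with x hx
  rw [weightedNormal, norm_smul]
  refine mul_le_mul ((hC x (mem_univ x)).trans (le_abs_self C)) ?_ (norm_nonneg _) (abs_nonneg C)
  refine (norm_add_le _ _).trans (add_le_add ?_ hx)
  rw [norm_smul]
  simpa using hCψ x

lemma integral_divergence_weight_smul [NeZero n] {w : ℝ → ℝ} (hw : ContDiff ℝ 1 w) {ψ : UnitSphere n → ℝ}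
    {K : NNReal} (hψ : LipschitzWith K ψ) (hpos : ∀ x, 0 < ψ x)
    {X : EuclideanSpace ℝ (Fin n) → EuclideanSpace ℝ (Fin n)} (hX : ContDiff ℝ 1 X)
    (hc : HasCompactSupport X) :
    ∫ y in {y | oneHom ψ y ≤ 1}, divergence (fun y => Real.exp (w ‖y‖) • X y) y
      = ∫ x : UnitSphere n, inner ℝ (weightedNormal w ψ x)
          (X ((ψ x)⁻¹ • (x : EuclideanSpace ℝ (Fin n)))) ∂(surfaceMeasure n) := by
  obtain ⟨L, hL⟩ := exists_lipschitzWith_weight_smul hw hX hc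
  rw [integral_divergence_eq hψ hpos hL (hc.smul_left (f := fun y => Real.exp (w ‖y‖)))]
  refine integral_congr_ae (Eventually.of_forall fun x => ?_)
  have hn : ‖(ψ x)⁻¹ • (x : EuclideanSpace ℝ (Fin n))‖ = (ψ x)⁻¹ := by
    rw [norm_smul, Real.norm_of_nonneg (inv_pos.mpr (hpos x)).le]; simp
  simp only [weightedNormal, hn, inner_smul_left, inner_smul_right, conj_trivial]
  ring

/-- Truncation to the unit ball. -/
lemma norm_sub_truncation_le {V : Type*} [NormedAddCommGroup V] [NormedSpace ℝ V] {a b : V}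
    (ha : ‖a‖ ≤ 1) : ‖(max 1 ‖b‖)⁻¹ • b - a‖ ≤ 2 * ‖b - a‖ := by
  rcases le_total ‖b‖ 1 with h | h
  · rw [max_eq_left h, inv_one, one_smul]; linarith [norm_nonneg (b - a)]
  · rw [max_eq_right h]
    have hb0 : 0 < ‖b‖ := by linarith
    have h1 : ‖‖b‖⁻¹ • b - b‖ = ‖b‖ - 1 := by
      have : ‖b‖⁻¹ • b - b = (‖b‖⁻¹ - 1) • b := by module
      have h2 : ‖b‖⁻¹ ≤ 1 := inv_le_one_of_one_le₀ h
      rw [this, norm_smul, Real.norm_of_nonpos (by linarith)]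
      field_simp; ring
    have h2 : ‖b‖ - 1 ≤ ‖b - a‖ := by linarith [norm_sub_norm_le b a]
    calc ‖‖b‖⁻¹ • b - a‖ = ‖(‖b‖⁻¹ • b - b) + (b - a)‖ := by congr 1; abel
      _ ≤ _ := (norm_add_le _ _).trans (by linarith)

/-- Measurable fields of norm at most `1` are approximated in `L¹` by admissible fields. -/
lemma exists_contDiff_integral_norm_sub_le (m : Measure (EuclideanSpace ℝ (Fin n))) [IsFiniteMeasure m]
    {ν : EuclideanSpace ℝ (Fin n) → EuclideanSpace ℝ (Fin n)} (hν : Measurable ν)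
    (hν1 : ∀ y, ‖ν y‖ ≤ 1) {δ : ℝ} (hδ : 0 < δ) :
    ∃ X : EuclideanSpace ℝ (Fin n) → EuclideanSpace ℝ (Fin n),
      (ContDiff ℝ 1 X ∧ HasCompactSupport X ∧ ∀ x, ‖X x‖ ≤ 1) ∧ ∫ y, ‖X y - ν y‖ ∂m ≤ δ := by
  have hνi : Integrable ν m := Integrable.of_bound hν.aestronglyMeasurable 1 (Eventually.of_forall hν1)
  obtain ⟨g, hgc, hgδ, hgcont, hgi⟩ := hνi.exists_hasCompactSupport_integral_sub_le
    (show 0 < δ / 4 by positivity)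
  -- A continuous L¹ approximation is truncated to the unit ball, smoothed within η, and divided by
  -- 1 + η to restore the norm bound.
  set h : EuclideanSpace ℝ (Fin n) → EuclideanSpace ℝ (Fin n) := fun y => (max 1 ‖g y‖)⁻¹ • g y
  have hpos : ∀ y, 0 < max 1 ‖g y‖ := fun y => lt_max_of_lt_left one_pos
  have hcont : Continuous h :=
    ((continuous_const.max hgcont.norm).inv₀ fun y => (hpos y).ne').smul hgcont
  have hh1 : ∀ y, ‖h y‖ ≤ 1 := by
    intro y
    rw [norm_smul, norm_inv, Real.norm_of_nonneg (hpos y).le, inv_mul_le_iff₀ (hpos y), mul_one]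
    exact le_max_right _ _
  set M := m.real univ
  -- By `hpt` the error is at most M · 2η + 2 · δ/4, and this η makes the first term at most δ/2.
  set η := δ / (4 * (M + 1)) with hη
  have hM0 : 0 ≤ M := measureReal_nonneg
  have hη0 : 0 < η := by positivity
  obtain ⟨Y, hY, hYd, hYs⟩ := hcont.exists_contDiff_approx (n := 1) (ε := fun _ => η) continuous_const
    (fun _ => hη0)
  have hY1 : ∀ y, ‖Y y‖ ≤ 1 + η := by
    intro y
    have h1 := hYd y
    rw [dist_eq_norm] at h1
    have h2 : ‖Y y‖ ≤ ‖Y y - h y‖ + ‖h y‖ := by simpa using norm_add_le (Y y - h y) (h y)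
    linarith [hh1 y]
  have hgsupp : HasCompactSupport Y := by
    refine hgc.mono (hYs.trans ?_)
    intro y hy hy0
    exact hy (by simp [h, hy0])
  refine ⟨fun y => (1 + η)⁻¹ • Y y, ⟨by exact_mod_cast hY.const_smul (1 + η)⁻¹, hgsupp.smul_left (f := fun _ => (1 + η)⁻¹),
    fun y => ?_⟩, ?_⟩
  · rw [norm_smul, norm_inv, Real.norm_of_nonneg (by positivity), inv_mul_le_iff₀ (by positivity), mul_one]
    exact hY1 y
  have hpt : ∀ y, ‖(1 + η)⁻¹ • Y y - ν y‖ ≤ 2 * η + 2 * ‖ν y - g y‖ := by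
    intro y
    have h1 : ‖(1 + η)⁻¹ • Y y - Y y‖ ≤ η := by
      have e : (1 + η)⁻¹ • Y y - Y y = (-(η * (1 + η)⁻¹)) • Y y := by
        have : -(η * (1 + η)⁻¹) = (1 + η)⁻¹ - 1 := by field_simp; ring
        rw [this]; module
      rw [e, norm_smul, norm_neg, Real.norm_of_nonneg (by positivity)]
      calc η * (1 + η)⁻¹ * ‖Y y‖ ≤ η * (1 + η)⁻¹ * (1 + η) := by gcongr; exact hY1 y
        _ = η := by field_simp
    have h2 := hYd y
    rw [dist_eq_norm] at h2
    have h3 := norm_sub_truncation_le (b := g y) (hν1 y)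
    rw [norm_sub_rev (g y)] at h3
    calc ‖(1 + η)⁻¹ • Y y - ν y‖
        = ‖((1 + η)⁻¹ • Y y - Y y) + (Y y - h y) + (h y - ν y)‖ := by congr 1; abel
      _ ≤ ‖(1 + η)⁻¹ • Y y - Y y‖ + ‖Y y - h y‖ + ‖h y - ν y‖ := norm_add₃_le
      _ ≤ _ := by linarith
  have hi : Integrable (fun y => ‖ν y - g y‖) m := (hνi.sub hgi).norm
  calc ∫ y, ‖(1 + η)⁻¹ • Y y - ν y‖ ∂m ≤ ∫ y, (2 * η + 2 * ‖ν y - g y‖) ∂m := by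
        refine integral_mono_of_nonneg (Eventually.of_forall fun y => norm_nonneg _)
          ((integrable_const _).add (hi.const_mul 2)) (Eventually.of_forall hpt)
    _ = M * (2 * η) + 2 * ∫ y, ‖ν y - g y‖ ∂m := by
        rw [integral_add (integrable_const _) (hi.const_mul 2)]
        simp only [integral_const_mul, integral_const, smul_eq_mul, M]
        ring
    _ ≤ M * (2 * η) + 2 * (δ / 4) := by gcongr
    _ ≤ δ := by
        have : M * (2 * η) ≤ δ / 2 := by
          rw [hη, show M * (2 * (δ / (4 * (M + 1)))) = δ / 2 * (M / (M + 1)) by field_simp; ring]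
          exact mul_le_of_le_one_right (by positivity) ((div_le_one (by positivity)).mpr (by linarith))
        linarith

/-- The weighted perimeter is the integral of the weighted surface element. -/
theorem weightedPerimeter_eq [NeZero n] {w : ℝ → ℝ} (hw : ContDiff ℝ 1 w) {ψ : UnitSphere n → ℝ}
    {K : NNReal} (hψ : LipschitzWith K ψ) (hpos : ∀ x, 0 < ψ x) :
    weightedPerimeter w {y | oneHom ψ y ≤ 1}
      = ENNReal.ofReal (∫ x, ‖weightedNormal w ψ x‖ ∂(surfaceMeasure n)) := by
  set N := weightedNormal w ψ
  have hNm : Measurable N := measurable_weightedNormal hw.continuous hψ.continuous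
  obtain ⟨M, hM0, hM⟩ := exists_bound_weightedNormal hw.continuous hψ hpos
  have hNi : Integrable (fun x => ‖N x‖) (surfaceMeasure n) :=
    Integrable.of_bound hNm.norm.aestronglyMeasurable M (by simpa using hM)
  set p : UnitSphere n → EuclideanSpace ℝ (Fin n) := fun x => (ψ x)⁻¹ • (x : EuclideanSpace ℝ (Fin n))
  have hp : Measurable p := by
    have : Measurable ψ := hψ.continuous.measurable
    fun_prop
  have hinner : ∀ X : EuclideanSpace ℝ (Fin n) → EuclideanSpace ℝ (Fin n), Measurable X → (∀ x, ‖X x‖ ≤ 1) →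
      Integrable (fun x => inner ℝ (N x) (X (p x))) (surfaceMeasure n) := by
    intro X hX hX1
    refine hNi.mono' (hNm.inner (hX.comp hp)).aestronglyMeasurable (Eventually.of_forall fun x => ?_)
    exact (norm_inner_le_norm _ _).trans (mul_le_of_le_one_right (norm_nonneg _) (hX1 _))
  refine le_antisymm ?_ ?_
  · refine iSup₂_le fun X hX => ENNReal.ofReal_le_ofReal ?_
    rw [integral_divergence_weight_smul hw hψ hpos hX.1 hX.2.1]
    refine integral_mono (hinner X hX.1.continuous.measurable hX.2.2) hNi fun x => ?_
    exact (real_inner_le_norm _ _).trans (mul_le_of_le_one_right (norm_nonneg _) (hX.2.2 _))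
  · obtain ⟨KG, hG⟩ := exists_lipschitzWith_oneHom hψ
    -- The unit normal, which attains equality in Cauchy–Schwarz; it is measurable everywhere
    -- because the inverse of 0 is 0.
    set ν : EuclideanSpace ℝ (Fin n) → EuclideanSpace ℝ (Fin n) := fun y =>
      ‖gradient (oneHom ψ) y‖⁻¹ • gradient (oneHom ψ) y
    have hνm : Measurable ν :=
      (measurable_gradient_euclidean _).norm.inv.smul (measurable_gradient_euclidean _)
    have hν1 : ∀ y, ‖ν y‖ ≤ 1 := by
      intro y
      rw [norm_smul, norm_inv, norm_norm]
      exact inv_mul_le_one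
    have hNν : ∀ᵐ x ∂(surfaceMeasure n), inner ℝ (N x) (ν (p x)) = ‖N x‖ := by
      filter_upwards [ae_differentiableAt_homogeneousExtension hψ] with x hx
      have hρ := inv_pos.mpr (hpos x)
      simp only [ν, p, N, weightedNormal, (hasGradientAt_oneHom hx hρ).gradient]
      set V := ψ x • (x : EuclideanSpace ℝ (Fin n)) + tangentialGradient ψ x
      have hc : 0 < (ψ x)⁻¹ ^ n * Real.exp (w (ψ x)⁻¹) := by positivity
      rw [inner_smul_left, inner_smul_right, norm_smul, Real.norm_of_nonneg hc.le,
        real_inner_self_eq_norm_sq, conj_trivial]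
      by_cases hV : ‖V‖ = 0
      · simp [hV]
      · field_simp
    refine ENNReal.le_of_forall_pos_le_add fun δ hδ _ => ?_
    -- The approximation is in L¹ of the push-forward of the surface measure, hence on the boundary
    -- itself. The total error is M times the tolerance δ/(M + 1), so at most δ.
    obtain ⟨X, hX, hXδ⟩ := exists_contDiff_integral_norm_sub_le ((surfaceMeasure n).map p) hνm hν1
      (show 0 < (δ : ℝ) / (M + 1) by positivity)
    have hXm : Measurable X := hX.1.continuous.measurable
    have hXν : Measurable fun y => ‖X y - ν y‖ := (hXm.sub hνm).norm
    rw [integral_map hp.aemeasurable hXν.aestronglyMeasurable] at hXδ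
    have hle : ∫ x, ‖N x‖ ∂(surfaceMeasure n) ≤ ∫ x, inner ℝ (N x) (X (p x)) ∂(surfaceMeasure n) + δ := by
      have hi2 : Integrable (fun x => ‖X (p x) - ν (p x)‖) (surfaceMeasure n) := by
        refine Integrable.of_bound (((hXm.sub hνm).comp hp).norm).aestronglyMeasurable 2
          (Eventually.of_forall fun x => ?_)
        rw [norm_norm]
        exact (norm_sub_le _ _).trans (by linarith [hX.2.2 (p x), hν1 (p x)])
      have h1 : ∫ x, ‖N x‖ ∂(surfaceMeasure n)
          ≤ ∫ x, (inner ℝ (N x) (X (p x)) + M * ‖X (p x) - ν (p x)‖) ∂(surfaceMeasure n) := by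
        refine integral_mono_ae hNi ((hinner X hXm hX.2.2).add (hi2.const_mul M)) ?_
        filter_upwards [hNν, hM] with x hx hMx
        have h2 : inner ℝ (N x) (ν (p x)) = inner ℝ (N x) (X (p x)) - inner ℝ (N x) (X (p x) - ν (p x)) := by
          rw [inner_sub_right]; ring
        have h3 : -inner ℝ (N x) (X (p x) - ν (p x)) ≤ M * ‖X (p x) - ν (p x)‖ := by
          refine (neg_le_abs _).trans ((abs_real_inner_le_norm _ _).trans ?_)
          exact mul_le_mul_of_nonneg_right hMx (norm_nonneg _)
        rw [← hx, h2]
        linarith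
      rw [integral_add (hinner X hXm hX.2.2) (hi2.const_mul M), integral_const_mul] at h1
      have h4 : M * ∫ x, ‖X (p x) - ν (p x)‖ ∂(surfaceMeasure n) ≤ δ := by
        calc M * ∫ x, ‖X (p x) - ν (p x)‖ ∂(surfaceMeasure n) ≤ M * (δ / (M + 1)) := by gcongr
          _ = δ * (M / (M + 1)) := by ring
          _ ≤ δ := mul_le_of_le_one_right δ.coe_nonneg ((div_le_one (by positivity)).mpr (by linarith))
      linarith
    calc ENNReal.ofReal (∫ x, ‖N x‖ ∂(surfaceMeasure n))
        ≤ ENNReal.ofReal (∫ x, inner ℝ (N x) (X (p x)) ∂(surfaceMeasure n) + δ) :=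
          ENNReal.ofReal_le_ofReal hle
      _ ≤ ENNReal.ofReal (∫ x, inner ℝ (N x) (X (p x)) ∂(surfaceMeasure n)) + δ := by
          refine ENNReal.ofReal_add_le.trans ?_
          rw [ENNReal.ofReal_coe_nnreal]
      _ ≤ weightedPerimeter w {y | oneHom ψ y ≤ 1} + δ := by
          gcongr
          rw [← integral_divergence_weight_smul hw hψ hpos hX.1 hX.2.1]
          exact le_iSup₂ (f := fun (X : EuclideanSpace ℝ (Fin n) → EuclideanSpace ℝ (Fin n))
            (_ : ContDiff ℝ 1 X ∧ HasCompactSupport X ∧ ∀ x, ‖X x‖ ≤ 1) =>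
            ENNReal.ofReal (∫ x in {y | oneHom ψ y ≤ 1}, divergence (fun y => Real.exp (w ‖y‖) • X y) x)) X hX

end Perimeter

/-! ### The radial densities -/

section Radial

open Set Measure Filter Topology

/-- The density `t^{n-1} e^{w t}` of the weighted volume and perimeter of balls. -/
noncomputable def radialDensity (n : ℕ) (w : ℝ → ℝ) (t : ℝ) : ℝ := t ^ (n - 1) * Real.exp (w t)

/-- The weighted volume of the ball of radius `t` per unit of solid angle. -/
noncomputable def radialVolume (n : ℕ) (w : ℝ → ℝ) (t : ℝ) : ℝ := ∫ s in (0 : ℝ)..t, radialDensity n w s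

lemma continuous_radialDensity (n : ℕ) {w : ℝ → ℝ} (hw : Continuous w) : Continuous (radialDensity n w) :=
  (continuous_pow _).mul hw.rexp

lemma hasDerivAt_radialVolume (n : ℕ) {w : ℝ → ℝ} (hw : Continuous w) (t : ℝ) :
    HasDerivAt (radialVolume n w) (radialDensity n w t) t :=
  intervalIntegral.integral_hasDerivAt_right ((continuous_radialDensity n hw).intervalIntegrable _ _)
    ((continuous_radialDensity n hw).stronglyMeasurableAtFilter _ _)
    (continuous_radialDensity n hw).continuousAt

lemma contDiff_radialVolume (n : ℕ) {w : ℝ → ℝ} (hw : Continuous w) : ContDiff ℝ 1 (radialVolume n w) := by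
  rw [contDiff_one_iff_deriv]
  refine ⟨fun t => (hasDerivAt_radialVolume n hw t).differentiableAt, ?_⟩
  have : deriv (radialVolume n w) = radialDensity n w := by
    ext t; exact (hasDerivAt_radialVolume n hw t).deriv
  rw [this]
  exact continuous_radialDensity n hw

lemma radialDensity_eq_exp (n : ℕ) (w : ℝ → ℝ) {t : ℝ} (ht : 0 < t) :
    radialDensity n w t = Real.exp (((n - 1 : ℕ) : ℝ) * Real.log t + w t) := by
  rw [radialDensity, Real.exp_add, Real.exp_nat_mul, Real.exp_log ht]

lemma hasDerivAt_radialDensity (n : ℕ) {w : ℝ → ℝ} (hw : Differentiable ℝ w) {t : ℝ} (ht : 0 < t) :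
    HasDerivAt (radialDensity n w)
      (radialDensity n w t * (((n - 1 : ℕ) : ℝ) / t + deriv w t)) t := by
  have h1 : HasDerivAt (fun t => Real.exp (((n - 1 : ℕ) : ℝ) * Real.log t + w t))
      (Real.exp (((n - 1 : ℕ) : ℝ) * Real.log t + w t) * (((n - 1 : ℕ) : ℝ) * t⁻¹ + deriv w t)) t :=
    (((Real.hasDerivAt_log ht.ne').const_mul _).add (hw t).hasDerivAt).exp
  rw [← radialDensity_eq_exp n w ht] at h1
  refine h1.congr_of_eventuallyEq ?_
  filter_upwards [lt_mem_nhds ht] with s hs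
  exact radialDensity_eq_exp n w hs

/-- Quantitative comparison of a function with its primitive around a point where the logarithmic
derivative does not decrease too fast. -/
lemma sub_ge_of_log_deriv {Θ φ l l' : ℝ → ℝ} {a b r m M κ : ℝ} (hr : r ∈ Icc a b)
    (hΘ : ∀ t ∈ Icc a b, HasDerivAt Θ (φ t) t) (hφ : ∀ t ∈ Icc a b, HasDerivAt φ (φ t * l t) t)
    (hl : ∀ t ∈ Icc a b, HasDerivAt l (l' t) t) (hm0 : 0 < m) (hm : ∀ t ∈ Icc a b, m ≤ φ t)
    (hM : ∀ t ∈ Icc a b, φ t ≤ M) (hκ0 : 0 ≤ κ) (hκ : ∀ t ∈ Icc a b, -κ ≤ l' t)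
    {t : ℝ} (ht : t ∈ Icc a b) :
    l r * (Θ t - Θ r) - κ * M / (2 * m ^ 2) * (Θ t - Θ r) ^ 2 ≤ φ t - φ r := by
  have hlmono : MonotoneOn (fun t => l t + κ * t) (Icc a b) := by
    refine monotoneOn_of_deriv_nonneg (convex_Icc a b) ?_ ?_ ?_
    · exact fun s hs => ((hl s hs).add ((hasDerivAt_id s).const_mul κ)).continuousAt.continuousWithinAt
    · exact fun s hs => ((hl s (interior_subset hs)).add
        ((hasDerivAt_id s).const_mul κ)).differentiableAt.differentiableWithinAt
    · intro s hs
      have hs' := interior_subset hs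
      have := ((hl s hs').add ((hasDerivAt_id s).const_mul κ)).deriv
      simp only [id] at this
      rw [show (fun t => l t + κ * t) = (l + fun t => κ * t) from rfl, this]
      linarith [hκ s hs']
  have hΘmono : MonotoneOn (fun t => Θ t - m * t) (Icc a b) := by
    refine monotoneOn_of_deriv_nonneg (convex_Icc a b) ?_ ?_ ?_
    · exact fun s hs => ((hΘ s hs).sub ((hasDerivAt_id s).const_mul m)).continuousAt.continuousWithinAt
    · exact fun s hs => ((hΘ s (interior_subset hs)).sub
        ((hasDerivAt_id s).const_mul m)).differentiableAt.differentiableWithinAt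
    · intro s hs
      have hs' := interior_subset hs
      have := ((hΘ s hs').sub ((hasDerivAt_id s).const_mul m)).deriv
      simp only [id] at this
      rw [show (fun t => Θ t - m * t) = (Θ - fun t => m * t) from rfl, this]
      linarith [hm s hs']
  -- The derivative of g has the sign of s - r, because l + κ·id is monotone and φ ≤ M; hence g has
  -- its minimum 0 at r.
  set g : ℝ → ℝ := fun t => φ t - φ r - l r * (Θ t - Θ r) + κ * M / 2 * (t - r) ^ 2
  have hg : ∀ s ∈ Icc a b, HasDerivAt g (φ s * (l s - l r) + κ * M * (s - r)) s := by
    intro s hs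
    have := ((((hφ s hs).sub_const (φ r)).sub (((hΘ s hs).sub_const (Θ r)).const_mul (l r)))).add
      ((((hasDerivAt_id s).sub_const r).pow 2).const_mul (κ * M / 2))
    convert! this using 1
    simp; ring
  have hgr : g r = 0 := by simp [g]
  have hgnn : 0 ≤ g t := by
    rcases le_total r t with h | h
    · have hmono : MonotoneOn g (Icc r b) := by
        have hsub : Icc r b ⊆ Icc a b := Icc_subset_Icc_left hr.1
        refine monotoneOn_of_deriv_nonneg (convex_Icc r b)
          (fun s hs => (hg s (hsub hs)).continuousAt.continuousWithinAt)
          (fun s hs => (hg s (hsub (interior_subset hs))).differentiableAt.differentiableWithinAt) ?_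
        intro s hs
        have hs1 := interior_subset hs
        have hs' := hsub hs1
        rw [(hg s hs').deriv]
        have h1 : l r + κ * r ≤ l s + κ * s := hlmono hr hs' hs1.1
        have h2 := hM s hs'
        have h3 : 0 < φ s := hm0.trans_le (hm s hs')
        have h4 : 0 ≤ s - r := sub_nonneg.mpr hs1.1
        have h5 : 0 ≤ φ s * (l s - l r + κ * (s - r)) := mul_nonneg h3.le (by linarith)
        have h6 : 0 ≤ (M - φ s) * (κ * (s - r)) := mul_nonneg (by linarith) (mul_nonneg hκ0 h4)
        linarith
      rw [← hgr]
      exact hmono ⟨le_refl r, hr.2⟩ ⟨h, ht.2⟩ h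
    · have hanti : AntitoneOn g (Icc a r) := by
        have hsub : Icc a r ⊆ Icc a b := Icc_subset_Icc_right hr.2
        refine antitoneOn_of_deriv_nonpos (convex_Icc a r)
          (fun s hs => (hg s (hsub hs)).continuousAt.continuousWithinAt)
          (fun s hs => (hg s (hsub (interior_subset hs))).differentiableAt.differentiableWithinAt) ?_
        intro s hs
        have hs1 := interior_subset hs
        have hs' := hsub hs1
        rw [(hg s hs').deriv]
        have h1 : l s + κ * s ≤ l r + κ * r := hlmono hs' hr hs1.2
        have h2 := hM s hs'
        have h3 : 0 < φ s := hm0.trans_le (hm s hs')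
        have h4 : 0 ≤ r - s := sub_nonneg.mpr hs1.2
        have h5 : 0 ≤ φ s * (l r - l s + κ * (r - s)) := mul_nonneg h3.le (by linarith)
        have h6 : 0 ≤ (M - φ s) * (κ * (r - s)) := mul_nonneg (by linarith) (mul_nonneg hκ0 h4)
        linarith
      rw [← hgr]
      exact hanti ⟨ht.1, h⟩ ⟨hr.1, le_refl r⟩ h
  -- Since Θ' ≥ m, the error can be expressed through Θ t - Θ r, the quantity to which the volume
  -- constraint and Poincaré apply.
  have hsq : (t - r) ^ 2 ≤ (Θ t - Θ r) ^ 2 / m ^ 2 := by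
    rw [le_div_iff₀ (by positivity), ← mul_pow]
    rcases le_total r t with h | h
    · have h1 : Θ r - m * r ≤ Θ t - m * t := hΘmono hr ht h
      exact pow_le_pow_left₀ (mul_nonneg (sub_nonneg.mpr h) hm0.le) (by linarith) 2
    · have h1 : Θ t - m * t ≤ Θ r - m * r := hΘmono ht hr h
      rw [show ((t - r) * m) ^ 2 = ((r - t) * m) ^ 2 by ring,
        show (Θ t - Θ r) ^ 2 = (Θ r - Θ t) ^ 2 by ring]
      exact pow_le_pow_left₀ (mul_nonneg (sub_nonneg.mpr h) hm0.le) (by linarith) 2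
  have hM0 : 0 ≤ M := hm0.le.trans ((hm t ht).trans (hM t ht))
  have hfin : κ * M / 2 * (t - r) ^ 2 ≤ κ * M / (2 * m ^ 2) * (Θ t - Θ r) ^ 2 := by
    calc κ * M / 2 * (t - r) ^ 2 ≤ κ * M / 2 * ((Θ t - Θ r) ^ 2 / m ^ 2) := by gcongr
      _ = _ := by field_simp
  simp only [g] at hgnn
  linarith

/-- The square of the left side is 1 + a - a³(8 - a)/64. The leading coefficient 1/2 has to be kept
intact, since gain and loss may be almost equal. -/
lemma one_add_le_sqrt {a : ℝ} (ha0 : 0 ≤ a) (ha : a ≤ 4) :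
    1 + a / 2 * (1 - a / 4) ≤ √(1 + a) := by
  refine Real.le_sqrt_of_sq_le ?_
  have : 0 ≤ a ^ 3 * (8 - a) := mul_nonneg (by positivity) (by linarith)
  nlinarith [this]

/-- Uniform bounds near `[r₁, r₂]`. -/
lemma exists_uniform_bounds (n : ℕ) {w : ℝ → ℝ} (hw : ContDiff ℝ 3 w) {r₁ r₂ : ℝ} (hr₁ : 0 < r₁)
    (hr₁₂ : r₁ < r₂) (hw'' : ∀ r ∈ Icc r₁ r₂, 0 < iteratedDeriv 2 w r) :
    ∃ ε₀ : ℝ, 0 < ε₀ ∧ ε₀ ≤ 1 / 2 ∧ ∃ m₀ : ℝ, 0 < m₀ ∧ ∃ L : ℝ, 0 ≤ L ∧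
      ∀ ε : ℝ, 0 ≤ ε → ε ≤ ε₀ → ∀ r ∈ Icc r₁ r₂, ∀ t ∈ Icc (r * (1 - ε)) (r * (1 + ε)),
        m₀ ≤ iteratedDeriv 2 w t ∧
        radialDensity n w r * Real.exp (-(L * ε)) ≤ radialDensity n w t ∧
        radialDensity n w t ≤ radialDensity n w r * Real.exp (L * ε) := by
  have hr₂ : 0 < r₂ := hr₁.trans hr₁₂
  have hcont : Continuous (iteratedDeriv 2 w) := hw.continuous_iteratedDeriv 2 (by norm_num)
  -- Positivity of w'' is an open condition, so it persists on a closed neighbourhood of the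
  -- interval, where compactness gives a positive minimum.
  obtain ⟨δ, hδ0, hδ⟩ := (isCompact_Icc (a := r₁) (b := r₂)).exists_cthickening_subset_open
    (isOpen_lt continuous_const hcont) (fun r hr => hw'' r hr)
  have hcomp : IsCompact (Metric.cthickening δ (Icc r₁ r₂)) := isCompact_Icc.cthickening
  have hne : (Metric.cthickening δ (Icc r₁ r₂)).Nonempty :=
    ⟨r₁, Metric.self_subset_cthickening _ (left_mem_Icc.mpr hr₁₂.le)⟩
  obtain ⟨t₀, ht₀, hmin⟩ := hcomp.exists_isMinOn hne hcont.continuousOn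
  -- A Lipschitz bound on the logarithm gives multiplicative bounds on the density, so that the
  -- density at r later factors out.
  set ℓ : ℝ → ℝ := fun t => ((n - 1 : ℕ) : ℝ) * Real.log t + w t
  have hℓ : ContDiffOn ℝ 1 ℓ (Icc (r₁ / 2) (2 * r₂)) := by
    refine ContDiffOn.add (contDiffOn_const.mul ?_) (hw.of_le (by norm_num)).contDiffOn
    exact Real.contDiffOn_log.mono fun t ht => by
      have : 0 < t := by linarith [ht.1]
      exact this.ne'
  obtain ⟨K, hK⟩ := hℓ.exists_lipschitzOnWith one_ne_zero (convex_Icc _ _) isCompact_Icc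
  -- The bound 1/2 keeps t in [r₁/2, 2r₂], and δ/r₂ keeps it in the thickening; r₂ in L comes from
  -- |t - r| ≤ ε r₂.
  refine ⟨min (1 / 2) (δ / r₂), by positivity, min_le_left _ _, iteratedDeriv 2 w t₀, hδ ht₀,
    K * r₂, by positivity, ?_⟩
  intro ε hε0 hε r hr t ht
  have hr0 : 0 < r := hr₁.trans_le hr.1
  have hε1 : ε ≤ 1 / 2 := hε.trans (min_le_left _ _)
  have hε2 : ε * r₂ ≤ δ := by
    have := hε.trans (min_le_right _ _)
    rwa [le_div_iff₀ hr₂] at this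
  have hdist : |t - r| ≤ ε * r₂ := by
    have h1 : r * ε ≤ r₂ * ε := mul_le_mul_of_nonneg_right hr.2 hε0
    rw [abs_le]; constructor <;> linarith [ht.1, ht.2]
  have ht0 : r₁ / 2 ≤ t := by nlinarith [ht.1, hr.1]
  have ht1 : t ≤ 2 * r₂ := by nlinarith [ht.2, hr.2]
  have htpos : 0 < t := by linarith
  have hlip := hK.dist_le_mul t ⟨ht0, ht1⟩ r ⟨by linarith [hr.1], by linarith [hr.2]⟩
  rw [Real.dist_eq, Real.dist_eq] at hlip
  have hlip2 : |ℓ t - ℓ r| ≤ K * r₂ * ε :=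
    hlip.trans ((mul_le_mul_of_nonneg_left hdist K.coe_nonneg).trans (le_of_eq (by ring)))
  rw [abs_le] at hlip2
  refine ⟨hmin ?_, ?_, ?_⟩
  · exact Metric.mem_cthickening_of_dist_le t r δ _ hr (by rw [Real.dist_eq]; linarith)
  · rw [radialDensity_eq_exp n w hr0, radialDensity_eq_exp n w htpos, ← Real.exp_add, Real.exp_le_exp]
    simp only [ℓ] at hlip2; linarith
  · rw [radialDensity_eq_exp n w hr0, radialDensity_eq_exp n w htpos, ← Real.exp_add, Real.exp_le_exp]
    simp only [ℓ] at hlip2; linarith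

/-- The constant of the stability estimate is positive for small `ε`. -/
lemma exists_small_constant {d κ₀ L ε₀ : ℝ} (hd : 0 < d) (hκ₀ : 0 < κ₀) (hε₀ : 0 < ε₀) :
    ∃ ε : ℝ, 0 < ε ∧ ε ≤ ε₀ ∧
      0 < Real.exp (-(L * ε)) * (1 - ε ^ 2) / (1 + ε) ^ 2
        - Real.exp (L * ε) ^ 3 / Real.exp (-(L * ε)) ^ 2 * (max 0 (d / (1 - ε) ^ 2 - κ₀) / d) := by
  set q : ℝ → ℝ := fun ε => Real.exp (-(L * ε)) * (1 - ε ^ 2) / (1 + ε) ^ 2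
        - Real.exp (L * ε) ^ 3 / Real.exp (-(L * ε)) ^ 2 * (max 0 (d / (1 - ε) ^ 2 - κ₀) / d)
  have hq : ContinuousAt q 0 := by
    have h1 : ContinuousAt (fun ε : ℝ => d / (1 - ε) ^ 2) 0 :=
      ContinuousAt.div (by fun_prop) (by fun_prop) (by norm_num)
    have h2 : ContinuousAt (fun ε : ℝ => max 0 (d / (1 - ε) ^ 2 - κ₀)) 0 :=
      continuousAt_const.max (h1.sub continuousAt_const)
    refine ContinuousAt.sub (ContinuousAt.div (by fun_prop) (by fun_prop) (by norm_num)) ?_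
    refine ContinuousAt.mul (ContinuousAt.div (by fun_prop) (by fun_prop) (by positivity)) ?_
    exact h2.div_const d
  -- The value at ε = 0 is 1 - max(0, d - κ₀)/d; its positivity is exactly where κ₀ > 0 is needed.
  have hq0 : 0 < q 0 := by
    have h : max 0 (d - κ₀) / d < 1 := by
      rw [div_lt_one hd]; exact max_lt hd (by linarith)
    simp [q]
    linarith
  obtain ⟨δ, hδ, hball⟩ := Metric.eventually_nhds_iff.mp (hq.eventually_const_lt hq0)
  refine ⟨min ε₀ (δ / 2), by positivity, min_le_left _ _, hball ?_⟩
  rw [Real.dist_eq, sub_zero, abs_of_pos (by positivity)]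
  exact (min_le_right _ _).trans_lt (by linarith)

end Radial

/-! ### Nearly spherical sets -/

section NearlySpherical

open Set Measure Filter Topology

variable {n : ℕ}

/-- The gauge of the nearly spherical set with radius `r` and profile `u`, on the sphere. -/
noncomputable def nearlyGauge (r : ℝ) (u : UnitSphere n → ℝ) (x : UnitSphere n) : ℝ := (r * (1 + u x))⁻¹

lemma nonempty_unitSphere (n : ℕ) [NeZero n] : Nonempty (UnitSphere n) :=
  ⟨⟨EuclideanSpace.single 0 1, by simp⟩⟩

lemma exists_Icc_of_mem_Ioo [NeZero n] {u : UnitSphere n → ℝ} (hu : Continuous u)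
    (hmem : ∀ x, u x ∈ Ioo (-1 : ℝ) 1) : ∃ a b, -1 < a ∧ ∀ x, u x ∈ Icc a b := by
  have := nonempty_unitSphere n
  obtain ⟨x₀, -, h₀⟩ := isCompact_univ.exists_isMinOn univ_nonempty hu.continuousOn
  exact ⟨u x₀, 1, (hmem x₀).1, fun x => ⟨h₀ (mem_univ x), (hmem x).2.le⟩⟩

lemma exists_lipschitzWith_comp {u : UnitSphere n → ℝ} {K : NNReal} (hu : LipschitzWith K u) {a b : ℝ}
    (hmem : ∀ x, u x ∈ Icc a b) {f : ℝ → ℝ} (hf : ContDiffOn ℝ 1 f (Icc a b)) :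
    ∃ K', LipschitzWith K' fun x => f (u x) := by
  obtain ⟨Kf, hKf⟩ := hf.exists_lipschitzOnWith one_ne_zero (convex_Icc a b) isCompact_Icc
  refine ⟨Kf * K, fun x y => ?_⟩
  refine (hKf (hmem x) (hmem y)).trans ?_
  rw [ENNReal.coe_mul, mul_assoc]
  gcongr
  exact hu x y

lemma exists_lipschitzWith_nearlyGauge [NeZero n] {r : ℝ} (hr : 0 < r) {u : UnitSphere n → ℝ} {K : NNReal}
    (hu : LipschitzWith K u) (hmem : ∀ x, u x ∈ Ioo (-1 : ℝ) 1) :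
    ∃ K', LipschitzWith K' (nearlyGauge r u) := by
  obtain ⟨a, b, ha, hab⟩ := exists_Icc_of_mem_Ioo hu.continuous hmem
  refine exists_lipschitzWith_comp hu hab (f := fun s => (r * (1 + s))⁻¹) ?_
  refine ContDiffOn.inv (by fun_prop) fun s hs => ?_
  have : 0 < 1 + s := by linarith [hs.1]
  positivity

lemma nearlyGauge_pos {r : ℝ} (hr : 0 < r) {u : UnitSphere n → ℝ} (hmem : ∀ x, u x ∈ Ioo (-1 : ℝ) 1)
    (x : UnitSphere n) : 0 < nearlyGauge r u x := by
  have : 0 < 1 + u x := by linarith [(hmem x).1]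
  unfold nearlyGauge; positivity

lemma IsNearlySpherical.eq_setOf_oneHom_le [NeZero n] {E : Set (EuclideanSpace ℝ (Fin n))} {r : ℝ}
    {u : UnitSphere n → ℝ} (h : IsNearlySpherical E r u) :
    E = {y | oneHom (nearlyGauge r u) y ≤ 1} := by
  have hr := h.radius_pos
  have hpos : ∀ x, 0 < r * (1 + u x) := fun x => mul_pos hr (by linarith [(h.mem_Ioo x).1])
  rw [h.eq_region]
  ext y
  simp only [mem_ofPred_eq]
  constructor
  · rintro ⟨x, t, ht, rfl⟩
    rw [oneHom_smul _ (mul_nonneg ht.1 (hpos x).le), nearlyGauge, mul_assoc,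
      mul_inv_cancel₀ (hpos x).ne', mul_one]
    exact ht.2
  · intro hy
    by_cases hy0 : y = 0
    · obtain ⟨x⟩ := nonempty_unitSphere n
      exact ⟨x, 0, ⟨le_refl _, zero_le_one⟩, by simp [hy0]⟩
    · obtain ⟨x, hx⟩ := exists_smul_sphere hy0
      rw [hx, oneHom_smul _ (norm_nonneg y)] at hy
      refine ⟨x, ‖y‖ * nearlyGauge r u x, ⟨?_, hy⟩, ?_⟩
      · exact mul_nonneg (norm_nonneg y) (nearlyGauge_pos hr h.mem_Ioo x).le
      · rw [nearlyGauge, mul_assoc, inv_mul_cancel₀ (hpos x).ne', mul_one]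
        exact hx

lemma setOf_oneHom_const_le {r : ℝ} (hr : 0 < r) :
    {y : EuclideanSpace ℝ (Fin n) | oneHom (nearlyGauge r fun _ => 0) y ≤ 1} = Metric.closedBall 0 r := by
  ext y
  simp only [mem_ofPred_eq, mem_closedBall_zero_iff]
  by_cases hy0 : y = 0
  · simp [hy0, oneHom_zero, hr.le]
  · obtain ⟨x, hx⟩ := exists_smul_sphere hy0
    have : oneHom (nearlyGauge r fun _ => 0) y = ‖y‖ * r⁻¹ := by
      conv_lhs => rw [hx, oneHom_smul _ (norm_nonneg y)]
      simp [nearlyGauge]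
    rw [this, mul_inv_le_iff₀ hr, one_mul]

lemma ball_ae_eq_closedBall [NeZero n] (r : ℝ) :
    (Metric.ball 0 r : Set (EuclideanSpace ℝ (Fin n))) =ᵐ[volume] Metric.closedBall 0 r := by
  have : Nonempty (Fin n) := ⟨0⟩
  rw [← Metric.ball_union_sphere]
  exact (union_ae_eq_left_of_ae_eq_empty (ae_eq_empty.mpr (addHaar_sphere volume 0 r))).symm

lemma weightedVolume_ball [NeZero n] (w : ℝ → ℝ) {r : ℝ} (hr : 0 < r) :
    weightedVolume w (Metric.ball (0 : EuclideanSpace ℝ (Fin n)) r)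
      = weightedVolume w {y : EuclideanSpace ℝ (Fin n) | oneHom (nearlyGauge r fun _ => 0) y ≤ 1} := by
  rw [setOf_oneHom_const_le hr]
  exact setLIntegral_congr (ball_ae_eq_closedBall r)

lemma weightedPerimeter_ball [NeZero n] (w : ℝ → ℝ) {r : ℝ} (hr : 0 < r) :
    weightedPerimeter w (Metric.ball (0 : EuclideanSpace ℝ (Fin n)) r)
      = weightedPerimeter w {y : EuclideanSpace ℝ (Fin n) | oneHom (nearlyGauge r fun _ => 0) y ≤ 1} := by
  rw [setOf_oneHom_const_le hr]
  refine iSup_congr fun X => iSup_congr fun _ => ?_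
  rw [setIntegral_congr_set (ball_ae_eq_closedBall r)]

lemma weightedVolume_eq [NeZero n] {w : ℝ → ℝ} (hw : Continuous w) {ψ : UnitSphere n → ℝ} {K : NNReal}
    (hψ : LipschitzWith K ψ) (hpos : ∀ x, 0 < ψ x) :
    weightedVolume w {y | oneHom ψ y ≤ 1}
      = ENNReal.ofReal (∫ x, radialVolume n w (ψ x)⁻¹ ∂(surfaceMeasure n)) := by
  obtain ⟨KG, hG⟩ := exists_lipschitzWith_oneHom hψ
  have hRm : MeasurableSet {y | oneHom ψ y ≤ 1} :=
    measurableSet_le hG.continuous.measurable measurable_const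
  have hm : Measurable fun y : EuclideanSpace ℝ (Fin n) => ENNReal.ofReal (Real.exp (w ‖y‖)) :=
    (hw.comp continuous_norm).rexp.measurable.ennreal_ofReal
  have hφ := continuous_radialDensity n hw
  have hnn : ∀ ρ : ℝ, ∀ s ∈ Ioc 0 ρ, 0 ≤ radialDensity n w s := fun ρ s hs =>
    mul_nonneg (pow_nonneg hs.1.le _) (Real.exp_pos _).le
  have hinner : ∀ x : UnitSphere n, ∫⁻ s in Ioi (0 : ℝ), ENNReal.ofReal (s ^ (n - 1)) *
      ({y | oneHom ψ y ≤ 1}.indicator (fun y => ENNReal.ofReal (Real.exp (w ‖y‖))))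
        (s • (x : EuclideanSpace ℝ (Fin n))) = ENNReal.ofReal (radialVolume n w (ψ x)⁻¹) := by
    intro x
    have hρ := inv_pos.mpr (hpos x)
    have e : ∀ s ∈ Ioi (0 : ℝ), ENNReal.ofReal (s ^ (n - 1)) *
        ({y | oneHom ψ y ≤ 1}.indicator (fun y => ENNReal.ofReal (Real.exp (w ‖y‖))))
        (s • (x : EuclideanSpace ℝ (Fin n)))
        = (Ioc 0 (ψ x)⁻¹).indicator (fun s => ENNReal.ofReal (radialDensity n w s)) s := by
      intro s hs
      have hs0 : (0 : ℝ) < s := hs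
      have hiff : s • (x : EuclideanSpace ℝ (Fin n)) ∈ {y | oneHom ψ y ≤ 1} ↔ s ∈ Ioc 0 (ψ x)⁻¹ := by
        rw [mem_ofPred_eq, oneHom_smul ψ hs0.le, mem_Ioc, le_inv_comm₀ hs0 (hpos x), ← one_div,
          le_div_iff₀ hs0, mul_comm]
        simp [hs0]
      by_cases hmem : s ∈ Ioc 0 (ψ x)⁻¹
      · rw [indicator_of_mem hmem, indicator_of_mem (hiff.mpr hmem), radialDensity,
          ENNReal.ofReal_mul (pow_nonneg hs0.le _)]
        simp [norm_smul, abs_of_pos hs0]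
      · rw [indicator_of_notMem hmem, indicator_of_notMem (fun h => hmem (hiff.mp h)), mul_zero]
    rw [setLIntegral_congr_fun measurableSet_Ioi e, lintegral_indicator measurableSet_Ioc,
      Measure.restrict_restrict measurableSet_Ioc, inter_eq_left.mpr (fun s hs => hs.1),
      radialVolume, intervalIntegral.integral_of_le hρ.le, ofReal_integral_eq_lintegral_ofReal]
    · exact (hφ.integrableOn_Icc (a := 0) (b := (ψ x)⁻¹)).mono_set Ioc_subset_Icc_self
    · filter_upwards [ae_restrict_mem measurableSet_Ioc] with s hs
      exact hnn _ s hs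
  rw [weightedVolume, ← lintegral_indicator hRm, lintegral_polar _ (hm.indicator hRm)]
  simp_rw [hinner]
  have hc : Continuous fun x => radialVolume n w (ψ x)⁻¹ :=
    (contDiff_radialVolume n hw).continuous.comp (hψ.continuous.inv₀ fun x => (hpos x).ne')
  rw [ofReal_integral_eq_lintegral_ofReal]
  · exact hc.integrable_of_hasCompactSupport (HasCompactSupport.of_compactSpace _)
  · refine Eventually.of_forall fun x => ?_
    have hρ := inv_pos.mpr (hpos x)
    simp only [Pi.zero_apply, radialVolume]
    rw [intervalIntegral.integral_of_le hρ.le]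
    exact setIntegral_nonneg measurableSet_Ioc (hnn _)

/-- The chain rule for u ↦ 1/(r(1+u)), together with the orthogonality of radial and tangential
parts, turns the gauge formula into the classical surface element of a radial graph. -/
lemma norm_weightedNormal_nearlyGauge [NeZero n] (w : ℝ → ℝ) {r : ℝ} (hr : 0 < r) {u : UnitSphere n → ℝ}
    {x : UnitSphere n} (hux : -1 < u x)
    (hd : DifferentiableAt ℝ (homogeneousExtension u) (x : EuclideanSpace ℝ (Fin n))) :
    ‖weightedNormal w (nearlyGauge r u) x‖ = radialDensity n w (r * (1 + u x))
      * √(1 + ‖tangentialGradient u x‖ ^ 2 / (1 + u x) ^ 2) := by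
  have h1 : 0 < 1 + u x := by linarith
  set ρ := r * (1 + u x) with hρ
  have hρ0 : 0 < ρ := mul_pos hr h1
  have hf : HasDerivAt (fun s => (r * (1 + s))⁻¹) (-r / ρ ^ 2) (u x) := by
    have : HasDerivAt (fun s => r * (1 + s)) r (u x) := by
      simpa using ((hasDerivAt_id (u x)).const_add 1).const_mul r
    exact this.inv hρ0.ne'
  have hg := (tangentialGradient_comp hd hf).1
  have hψ : nearlyGauge r u x = ρ⁻¹ := rfl
  have hn : ‖nearlyGauge r u x • (x : EuclideanSpace ℝ (Fin n)) + tangentialGradient (nearlyGauge r u) x‖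
      = ρ⁻¹ * √(1 + ‖tangentialGradient u x‖ ^ 2 / (1 + u x) ^ 2) := by
    rw [← sq_eq_sq₀ (norm_nonneg _) (by positivity), norm_sq_add_tangentialGradient, mul_pow,
      Real.sq_sqrt (by positivity), hψ]
    have : ‖tangentialGradient (nearlyGauge r u) x‖ ^ 2
        = (r / ρ ^ 2) ^ 2 * ‖tangentialGradient u x‖ ^ 2 := by
      rw [show nearlyGauge r u = fun x => (r * (1 + u x))⁻¹ from rfl, hg, norm_smul, mul_pow]
      congr 1
      rw [Real.norm_eq_abs, sq_abs]; ring
    rw [this, hρ]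
    field_simp
  rw [weightedNormal, norm_smul, hn, hψ, inv_inv, Real.norm_of_nonneg (by positivity), radialDensity]
  have hp : ρ ^ n = ρ ^ (n - 1) * ρ := by
    rw [← pow_succ, Nat.sub_add_cancel (Nat.pos_of_ne_zero (NeZero.ne n))]
  rw [hp]
  field_simp

lemma ae_abs_lt_of_eLpNorm_top_lt {V : Type*} [NormedAddCommGroup V] {α : Type*} [MeasurableSpace α]
    {μ : Measure α} {f : α → V} {ε : ℝ} (h : eLpNorm f ⊤ μ < ENNReal.ofReal ε) :
    ∀ᵐ x ∂μ, ‖f x‖ < ε := by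
  rw [eLpNorm_exponent_top] at h
  filter_upwards [ae_le_eLpNormEssSup (f := f) (μ := μ)] with x hx
  have := hx.trans_lt h
  rw [← ofReal_norm] at this
  exact (ENNReal.ofReal_lt_ofReal_iff_of_nonneg (norm_nonneg _)).mp this

end NearlySpherical

/-! ### Stability under the volume constraint -/

open Set Measure Filter Topology in
/-- The stability estimate for the surface integrals. -/
lemma nearlySpherical_integral_stability {n : ℕ} (hn : 2 ≤ n) [NeZero n] {w : ℝ → ℝ} (hw : ContDiff ℝ 3 w)
    {r ε κ₀ m M : ℝ} (hr : 0 < r) (hε0 : 0 < ε) (hε1 : ε ≤ 1 / 2) (hm0 : 0 < m)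
    (hbounds : ∀ t ∈ Icc (r * (1 - ε)) (r * (1 + ε)), κ₀ ≤ r ^ 2 * iteratedDeriv 2 w t ∧
      m ≤ radialDensity n w t ∧ radialDensity n w t ≤ M)
    {u : UnitSphere n → ℝ} {K : NNReal} (hu : LipschitzWith K u) (hmem : ∀ x, u x ∈ Ioo (-1 : ℝ) 1)
    (hu1 : ∀ᵐ x ∂(surfaceMeasure n), |u x| < ε)
    (hu2 : ∀ᵐ x ∂(surfaceMeasure n), ‖tangentialGradient u x‖ < ε)
    (hvol : ∫ x, (radialVolume n w (r * (1 + u x)) - radialVolume n w r) ∂(surfaceMeasure n) = 0) :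
    1 / 2 * (m * (1 - ε ^ 2) / (1 + ε) ^ 2
        - M ^ 3 / m ^ 2 * (max 0 (((n : ℝ) - 1) / (1 - ε) ^ 2 - κ₀) / ((n : ℝ) - 1)))
      * ∫ x, ‖tangentialGradient u x‖ ^ 2 ∂(surfaceMeasure n)
      ≤ ∫ x, (‖weightedNormal w (nearlyGauge r u) x‖ - radialDensity n w r) ∂(surfaceMeasure n) := by
  have hd1 : (0 : ℝ) < (n : ℝ) - 1 := by
    have : (2 : ℝ) ≤ n := by exact_mod_cast hn
    linarith
  have hwd : Differentiable ℝ w := hw.differentiable (by norm_num)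
  have hwc : Continuous w := hw.continuous
  have hwd2 : ∀ t, HasDerivAt (deriv w) (iteratedDeriv 2 w t) t := by
    intro t
    have h : Differentiable ℝ (iteratedDeriv 1 w) :=
      hw.differentiable_iteratedDeriv 1 (by norm_num)
    rw [iteratedDeriv_one] at h
    have := (h t).hasDerivAt
    rwa [show iteratedDeriv 2 w = deriv (deriv w) by rw [iteratedDeriv_succ, iteratedDeriv_one]]
  have hcast : ((n - 1 : ℕ) : ℝ) = (n : ℝ) - 1 := by
    rw [Nat.cast_sub (by omega)]; simp
  -- κ/r² bounds -l' = (n-1)/t² - w'' from above, by t ≥ r(1 - ε) and r² w'' ≥ κ₀. The maximum with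
  -- 0 covers the case where w'' dominates.
  set κ := max 0 (((n : ℝ) - 1) / (1 - ε) ^ 2 - κ₀)
  have hκ0 : 0 ≤ κ := le_max_left _ _
  set a := r * (1 - ε)
  set b := r * (1 + ε)
  have ha0 : 0 < a := mul_pos hr (by linarith)
  have hrab : r ∈ Icc a b := by
    constructor
    · simp only [a]; nlinarith
    · simp only [b]; nlinarith
  have hM0 : 0 < M := hm0.trans_le ((hbounds r hrab).2.1.trans (hbounds r hrab).2.2)
  have hpos : ∀ t ∈ Icc a b, 0 < t := fun t ht => ha0.trans_le ht.1
  set l : ℝ → ℝ := fun t => ((n - 1 : ℕ) : ℝ) / t + deriv w t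
  set v : UnitSphere n → ℝ := fun x => radialVolume n w (r * (1 + u x)) - radialVolume n w r
  set D := ∫ x, ‖tangentialGradient u x‖ ^ 2 ∂(surfaceMeasure n)
  -- pointwise comparison with the volume
  have hpt : ∀ t ∈ Icc a b, l r * (radialVolume n w t - radialVolume n w r)
      - (κ / r ^ 2) * M / (2 * m ^ 2) * (radialVolume n w t - radialVolume n w r) ^ 2
      ≤ radialDensity n w t - radialDensity n w r := by
    intro t ht
    refine sub_ge_of_log_deriv (l' := fun t => -((n : ℝ) - 1) / t ^ 2 + iteratedDeriv 2 w t) hrab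
      (fun t _ => hasDerivAt_radialVolume n hwc t)
      (fun t ht => hasDerivAt_radialDensity n hwd (hpos t ht)) (fun t ht => ?_) hm0
      (fun t ht => (hbounds t ht).2.1) (fun t ht => (hbounds t ht).2.2) (by positivity) (fun t ht => ?_) ht
    · have h1 : HasDerivAt (fun t : ℝ => ((n - 1 : ℕ) : ℝ) / t) (-((n : ℝ) - 1) / t ^ 2) t := by
        have := (hasDerivAt_inv (hpos t ht).ne').const_mul ((n - 1 : ℕ) : ℝ)
        simp only [← div_eq_mul_inv] at this
        convert! this using 1
        rw [hcast]; ring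
      exact h1.add (hwd2 t)
    · have ht0 := hpos t ht
      have h1 := (hbounds t ht).1
      have h2 : ((n : ℝ) - 1) / (1 - ε) ^ 2 - κ₀ ≤ κ := le_max_right _ _
      have h3 : r ^ 2 * (((n : ℝ) - 1) / t ^ 2) ≤ ((n : ℝ) - 1) / (1 - ε) ^ 2 := by
        have h4 : (r * (1 - ε)) ^ 2 ≤ t ^ 2 := pow_le_pow_left₀ ha0.le ht.1 2
        have h5 : 0 < (1 - ε) ^ 2 := by
          have : 0 < 1 - ε := by linarith
          positivity
        rw [mul_div_assoc', div_le_div_iff₀ (by positivity) h5]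
        rw [mul_pow] at h4
        nlinarith
      have h6 : 0 ≤ κ - r ^ 2 * (((n : ℝ) - 1) / t ^ 2) + r ^ 2 * iteratedDeriv 2 w t := by linarith
      have h7 : 0 ≤ (κ - r ^ 2 * (((n : ℝ) - 1) / t ^ 2) + r ^ 2 * iteratedDeriv 2 w t) / r ^ 2 := by
        positivity
      have h8 : (κ - r ^ 2 * (((n : ℝ) - 1) / t ^ 2) + r ^ 2 * iteratedDeriv 2 w t) / r ^ 2
          = κ / r ^ 2 - ((n : ℝ) - 1) / t ^ 2 + iteratedDeriv 2 w t := by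
        field_simp
      rw [h8] at h7
      rw [neg_div]
      linarith
  -- the Poincaré inequality for the volume function
  obtain ⟨a', b', -, hab'⟩ := exists_Icc_of_mem_Ioo hu.continuous hmem
  have hfv : ∀ s, HasDerivAt (fun s => radialVolume n w (r * (1 + s)) - radialVolume n w r)
      (radialDensity n w (r * (1 + s)) * r) s := by
    intro s
    have h1 : HasDerivAt (fun s => r * (1 + s)) r s := by
      simpa using ((hasDerivAt_id s).const_add 1).const_mul r
    exact ((hasDerivAt_radialVolume n hwc (r * (1 + s))).comp s h1).sub_const _
  have hfC : ContDiff ℝ 1 fun s => radialVolume n w (r * (1 + s)) - radialVolume n w r :=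
    ((contDiff_radialVolume n hwc).comp (by fun_prop)).sub contDiff_const
  obtain ⟨Kv, hKv⟩ := exists_lipschitzWith_comp hu hab' hfC.contDiffOn
  -- The constraint gives v mean zero exactly, whereas u has mean zero only to first order; working
  -- with v avoids correction terms.
  have hpoin := sphere_poincare hKv hvol
  have hvi : Integrable v (surfaceMeasure n) :=
    hKv.continuous.integrable_of_hasCompactSupport (HasCompactSupport.of_compactSpace _)
  have hv2i : Integrable (fun x => v x ^ 2) (surfaceMeasure n) :=
    (hKv.continuous.pow 2).integrable_of_hasCompactSupport (HasCompactSupport.of_compactSpace _)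
  have hDi : Integrable (fun x => ‖tangentialGradient u x‖ ^ 2) (surfaceMeasure n) := by
    refine Integrable.of_bound ((measurable_tangentialGradient u).norm.pow_const 2).aestronglyMeasurable
      (ε ^ 2) ?_
    filter_upwards [hu2] with x hx
    rw [norm_pow, norm_norm]
    exact pow_le_pow_left₀ (norm_nonneg _) hx.le 2
  have hin : ∀ x, |u x| < ε → r * (1 + u x) ∈ Icc a b := by
    intro x hx
    rw [abs_lt] at hx
    exact ⟨mul_le_mul_of_nonneg_left (by linarith) hr.le, mul_le_mul_of_nonneg_left (by linarith) hr.le⟩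
  have hgv : ∫ x, ‖tangentialGradient v x‖ ^ 2 ∂(surfaceMeasure n) ≤ M ^ 2 * r ^ 2 * D := by
    rw [← integral_const_mul]
    refine integral_mono_of_nonneg (Eventually.of_forall fun x => by positivity) (hDi.const_mul _) ?_
    filter_upwards [hu1, ae_differentiableAt_homogeneousExtension hu] with x hx hdx
    have h1 : tangentialGradient v x = (radialDensity n w (r * (1 + u x)) * r) • tangentialGradient u x :=
      (tangentialGradient_comp hdx (hfv (u x))).1
    have h2 := hbounds _ (hin x hx)
    have h3 : 0 ≤ radialDensity n w (r * (1 + u x)) := hm0.le.trans h2.2.1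
    rw [h1, norm_smul, mul_pow, Real.norm_of_nonneg (by positivity), mul_pow]
    gcongr
    exact h2.2.2
  -- integration of the pointwise bound
  set c₁ := (κ / r ^ 2) * M / (2 * m ^ 2) with hc₁
  set c₂ := m * (1 - ε ^ 2) / (2 * (1 + ε) ^ 2) with hc₂
  have hε2 : 0 ≤ 1 - ε ^ 2 := by nlinarith
  have hc₁0 : 0 ≤ c₁ := by positivity
  have hgauge := exists_lipschitzWith_nearlyGauge hr hu hmem
  obtain ⟨Kg, hKg⟩ := hgauge
  have hNm := measurable_weightedNormal hwc hKg.continuous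
  obtain ⟨MN, -, hMN⟩ := exists_bound_weightedNormal hwc hKg (nearlyGauge_pos hr hmem)
  have hNi : Integrable (fun x => ‖weightedNormal w (nearlyGauge r u) x‖ - radialDensity n w r)
      (surfaceMeasure n) :=
    (Integrable.of_bound hNm.norm.aestronglyMeasurable MN (by simpa using hMN)).sub (integrable_const _)
  have hmain : ∫ x, (l r * v x - c₁ * v x ^ 2 + c₂ * ‖tangentialGradient u x‖ ^ 2) ∂(surfaceMeasure n)
      ≤ ∫ x, (‖weightedNormal w (nearlyGauge r u) x‖ - radialDensity n w r) ∂(surfaceMeasure n) := by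
    refine integral_mono_ae (((hvi.const_mul _).sub (hv2i.const_mul _)).add (hDi.const_mul _)) hNi ?_
    filter_upwards [hu1, hu2, ae_differentiableAt_homogeneousExtension hu] with x hx hgx hdx
    rw [norm_weightedNormal_nearlyGauge w hr (hmem x).1 hdx]
    have h1 := hpt _ (hin x hx)
    have h2 := (hbounds _ (hin x hx)).2.1
    rw [abs_lt] at hx
    set φ := radialDensity n w (r * (1 + u x))
    set g := ‖tangentialGradient u x‖
    have hg0 : 0 ≤ g := norm_nonneg _
    have hu0 : 1 / 2 ≤ 1 + u x := by linarith [hx.1]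
    -- Since 4ε² ≤ 1 this meets the requirement of `one_add_le_sqrt`, and it bounds the correction
    -- factor 1 - a/4 below by 1 - ε².
    have hq : g ^ 2 / (1 + u x) ^ 2 ≤ 4 * ε ^ 2 := by
      rw [div_le_iff₀ (by positivity)]
      have h3 : g ^ 2 ≤ ε ^ 2 := pow_le_pow_left₀ hg0 hgx.le 2
      have h4 : (1 / 2 : ℝ) ^ 2 ≤ (1 + u x) ^ 2 := pow_le_pow_left₀ (by norm_num) hu0 2
      nlinarith [mul_le_mul_of_nonneg_left h4 (show 0 ≤ 4 * ε ^ 2 by positivity)]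
    have hsq := one_add_le_sqrt (a := g ^ 2 / (1 + u x) ^ 2) (by positivity) (by nlinarith)
    have hlow : g ^ 2 / (1 + ε) ^ 2 ≤ g ^ 2 / (1 + u x) ^ 2 := by
      apply div_le_div_of_nonneg_left (by positivity) (by positivity)
      exact pow_le_pow_left₀ (by linarith) (by linarith [hx.2]) 2
    have hlow2 : g ^ 2 / (1 + ε) ^ 2 / 2 * (1 - ε ^ 2)
        ≤ g ^ 2 / (1 + u x) ^ 2 / 2 * (1 - g ^ 2 / (1 + u x) ^ 2 / 4) := by
      apply mul_le_mul (by linarith) (by linarith) hε2 (by positivity)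
    have hφ0 : 0 ≤ φ := hm0.le.trans h2
    have h5 : φ * (1 + g ^ 2 / (1 + ε) ^ 2 / 2 * (1 - ε ^ 2)) ≤ φ * √(1 + g ^ 2 / (1 + u x) ^ 2) :=
      mul_le_mul_of_nonneg_left (by linarith) hφ0
    have h6 : c₂ * g ^ 2 ≤ φ * (g ^ 2 / (1 + ε) ^ 2 / 2 * (1 - ε ^ 2)) := by
      have : c₂ * g ^ 2 = m * (g ^ 2 / (1 + ε) ^ 2 / 2 * (1 - ε ^ 2)) := by
        rw [hc₂]; field_simp
      rw [this]
      exact mul_le_mul_of_nonneg_right h2 (by positivity)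
    simp only [v]
    linarith
  have i1 : Integrable (fun x => l r * v x - c₁ * v x ^ 2) (surfaceMeasure n) :=
    (hvi.const_mul _).sub (hv2i.const_mul _)
  -- The linear term drops out by `hvol`; what is left is the gain c₂ D against the loss c₁ ∫v².
  rw [integral_add i1 (hDi.const_mul _), integral_sub (hvi.const_mul _) (hv2i.const_mul _),
    integral_const_mul, integral_const_mul, integral_const_mul, hvol, mul_zero, zero_sub] at hmain
  refine le_trans ?_ hmain
  set Vv := ∫ x, v x ^ 2 ∂(surfaceMeasure n)
  have hVv : Vv ≤ M ^ 2 * r ^ 2 * D / ((n : ℝ) - 1) := by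
    rw [le_div_iff₀ hd1]
    linarith [hpoin.trans hgv]
  have h1 : c₁ * Vv ≤ c₁ * (M ^ 2 * r ^ 2 * D / ((n : ℝ) - 1)) := mul_le_mul_of_nonneg_left hVv hc₁0
  have h2 : c₁ * (M ^ 2 * r ^ 2 * D / ((n : ℝ) - 1))
      = 1 / 2 * (M ^ 3 / m ^ 2 * (κ / ((n : ℝ) - 1))) * D := by
    rw [hc₁]; field_simp
  have h3 : c₂ * D = 1 / 2 * (m * (1 - ε ^ 2) / (1 + ε) ^ 2) * D := by
    rw [hc₂]; field_simp
  linarith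

theorem proposition3p2 (n : ℕ) (hn : 2 ≤ n) (w : ℝ → ℝ) (hw : ContDiff ℝ 3 w)
    (hw_even : ∀ s, w (-s) = w s) (hw_convex : ConvexOn ℝ Set.univ w)
    (r₁ r₂ : ℝ) (hr₁ : 0 < r₁) (hr₁₂ : r₁ < r₂)
    (hw'' : ∀ r ∈ Set.Icc r₁ r₂, 0 < iteratedDeriv 2 w r) :
    ∃ ε : ℝ, 0 < ε ∧ ∃ c : ℝ, 0 < c ∧ ∀ r ∈ Set.Icc r₁ r₂,
      ∀ (E : Set (EuclideanSpace ℝ (Fin n))) (u : UnitSphere n → ℝ),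
        IsNearlySpherical E r u →
        w1InftyNorm u < ENNReal.ofReal ε →
        weightedVolume w E = weightedVolume w (Metric.ball (0 : EuclideanSpace ℝ (Fin n)) r) →
        weightedPerimeter w (Metric.ball (0 : EuclideanSpace ℝ (Fin n)) r) ≠ ⊤ ∧
        weightedPerimeter w E ≠ ⊤ ∧
        (weightedPerimeter w E).toReal
            - (weightedPerimeter w (Metric.ball (0 : EuclideanSpace ℝ (Fin n)) r)).toReal
          ≥ c * r ^ (n - 1) * Real.exp (w r)
              * ∫ x, ‖tangentialGradient u x‖ ^ 2 ∂(surfaceMeasure n) := by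
  have : NeZero n := ⟨by omega⟩
  have hd1 : (0 : ℝ) < (n : ℝ) - 1 := by
    have : (2 : ℝ) ≤ n := by exact_mod_cast hn
    linarith
  have hw1 : ContDiff ℝ 1 w := hw.of_le (by norm_num)
  have hwc : Continuous w := hw.continuous
  obtain ⟨ε₀, hε₀, hε₀', m₀, hm₀, L, hL, hunif⟩ := exists_uniform_bounds n hw hr₁ hr₁₂ hw''
  -- r₁² m₀ is a lower bound for r² w'' valid for all r in the interval at once, so ε does not
  -- depend on r.
  obtain ⟨ε, hε, hεε₀, hq⟩ := exists_small_constant (L := L) hd1 (κ₀ := r₁ ^ 2 * m₀) (by positivity) hε₀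
  set q := Real.exp (-(L * ε)) * (1 - ε ^ 2) / (1 + ε) ^ 2 - Real.exp (L * ε) ^ 3 / Real.exp (-(L * ε)) ^ 2
    * (max 0 (((n : ℝ) - 1) / (1 - ε) ^ 2 - r₁ ^ 2 * m₀) / ((n : ℝ) - 1)) with hqdef
  refine ⟨ε, hε, q / 2, by positivity, fun r hr E u hE hnorm hvolE => ?_⟩
  have hr0 : 0 < r := hr₁.trans_le hr.1
  obtain ⟨K, hu⟩ := hE.lipschitz
  have hmem := hE.mem_Ioo
  have hEeq := hE.eq_setOf_oneHom_le
  obtain ⟨Kg, hKg⟩ := exists_lipschitzWith_nearlyGauge hr0 hu hmem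
  have hgpos := nearlyGauge_pos hr0 hmem
  have hmem0 : ∀ x : UnitSphere n, (fun _ : UnitSphere n => (0 : ℝ)) x ∈ Set.Ioo (-1 : ℝ) 1 := fun x => by
    simp
  have hu0 : LipschitzWith 0 fun _ : UnitSphere n => (0 : ℝ) := LipschitzWith.const 0
  obtain ⟨Kg0, hKg0⟩ := exists_lipschitzWith_nearlyGauge hr0 hu0 hmem0
  have hgpos0 := nearlyGauge_pos hr0 hmem0
  have hPE : weightedPerimeter w E
      = ENNReal.ofReal (∫ x, ‖weightedNormal w (nearlyGauge r u) x‖ ∂(surfaceMeasure n)) := by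
    rw [hEeq]; exact weightedPerimeter_eq hw1 hKg hgpos
  have hPB : weightedPerimeter w (Metric.ball (0 : EuclideanSpace ℝ (Fin n)) r)
      = ENNReal.ofReal (∫ x : UnitSphere n, radialDensity n w r ∂(surfaceMeasure n)) := by
    rw [weightedPerimeter_ball w hr0, weightedPerimeter_eq hw1 hKg0 hgpos0]
    congr 1
    refine integral_congr_ae ?_
    filter_upwards [ae_differentiableAt_homogeneousExtension hu0] with x hx
    have h0 : tangentialGradient (fun _ : UnitSphere n => (0 : ℝ)) x = 0 := by
      have := (tangentialGradient_comp hx (hasDerivAt_const ((0 : ℝ)) (0 : ℝ))).1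
      simpa using this
    rw [norm_weightedNormal_nearlyGauge w hr0 (by norm_num) hx, h0]
    simp
  have hvol : ∫ x, (radialVolume n w (r * (1 + u x)) - radialVolume n w r) ∂(surfaceMeasure n) = 0 := by
    rw [weightedVolume_ball w hr0, hEeq, weightedVolume_eq hwc hKg hgpos,
      weightedVolume_eq hwc hKg0 hgpos0] at hvolE
    simp only [nearlyGauge, inv_inv, add_zero, mul_one] at hvolE
    have hrv : ∀ t : ℝ, 0 < t → 0 ≤ radialVolume n w t := by
      intro t ht
      refine intervalIntegral.integral_nonneg ht.le fun s hs => ?_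
      exact mul_nonneg (pow_nonneg hs.1 _) (Real.exp_pos _).le
    have hpos : ∀ x, 0 < r * (1 + u x) := fun x => mul_pos hr0 (by linarith [(hmem x).1])
    rw [ENNReal.ofReal_eq_ofReal_iff (integral_nonneg fun x => hrv _ (hpos x))
      (integral_nonneg fun x => hrv _ hr0)] at hvolE
    have hc : Continuous fun x => radialVolume n w (r * (1 + u x)) :=
      (contDiff_radialVolume n hwc).continuous.comp
        (continuous_const.mul (continuous_const.add hu.continuous))
    rw [integral_sub (hc.integrable_of_hasCompactSupport (HasCompactSupport.of_compactSpace _))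
      (integrable_const _), hvolE, sub_self]
  have hu1 : ∀ᵐ x ∂(surfaceMeasure n), |u x| < ε :=
    ae_abs_lt_of_eLpNorm_top_lt (lt_of_le_of_lt le_self_add hnorm)
  have hu2 : ∀ᵐ x ∂(surfaceMeasure n), ‖tangentialGradient u x‖ < ε :=
    ae_abs_lt_of_eLpNorm_top_lt (lt_of_le_of_lt le_add_self hnorm)
  set A := radialDensity n w r with hA
  have hA0 : 0 < A := mul_pos (pow_pos hr0 _) (Real.exp_pos _)
  -- Both density bounds are multiples of A, and M³/m² is of degree 1 in A; so A = r^(n-1) e^(w r)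
  -- factors out and leaves q/2, independent of r.
  have hstab := nearlySpherical_integral_stability hn hw hr0 hε (hεε₀.trans hε₀')
    (κ₀ := r₁ ^ 2 * m₀) (m := A * Real.exp (-(L * ε))) (M := A * Real.exp (L * ε)) (by positivity)
    (fun t ht => by
      obtain ⟨h1, h2, h3⟩ := hunif ε hε.le hεε₀ r hr t ht
      refine ⟨?_, h2, h3⟩
      have : r₁ ^ 2 ≤ r ^ 2 := pow_le_pow_left₀ hr₁.le hr.1 2
      exact mul_le_mul this h1 hm₀.le (by positivity)) hu hmem hu1 hu2 hvol
  have hNm := measurable_weightedNormal hwc hKg.continuous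
  obtain ⟨MN, -, hMN⟩ := exists_bound_weightedNormal hwc hKg hgpos
  have hNi : Integrable (fun x => ‖weightedNormal w (nearlyGauge r u) x‖) (surfaceMeasure n) :=
    Integrable.of_bound hNm.norm.aestronglyMeasurable MN (by simpa using hMN)
  rw [integral_sub hNi (integrable_const _)] at hstab
  refine ⟨by rw [hPB]; exact ENNReal.ofReal_ne_top, by rw [hPE]; exact ENNReal.ofReal_ne_top, ?_⟩
  rw [hPE, hPB, ENNReal.toReal_ofReal (integral_nonneg fun x => norm_nonneg _),
    ENNReal.toReal_ofReal (integral_nonneg fun x => hA0.le)]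
  refine ge_iff_le.mpr (le_trans (le_of_eq ?_) hstab)
  rw [mul_assoc (q / 2), show r ^ (n - 1) * Real.exp (w r) = A from rfl]
  congr 1
  rw [hqdef]
  have := Real.exp_pos (-(L * ε))
  field_simp
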